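/- Let $M$ be a closed oriented smooth surface of genus at least two, $\widetilde M$ its universal cover, and let $(h,h^\star)$ be a pair of hyperbolic metrics on $M$. Let $b:TM\to TM$ be a Labourie operator of the pair: $b$ is smooth, self-adjoint for $h$, $\det b=1$, $\nabla_u(bv)-\nabla_v(bu)=b[u,v]$ for the Levi-Civita connection $\nabla$ of $h$, and $h(b\,\cdot,b\,\cdot)$ is isometric to $h^\star$ by a diffeomorphism isotopic to the identity (replace $h^\star$ by $h(b\,\cdot,b\,\cdot)$, which represents the same point of Teichmüller space). These conditions determine $b$ up to sign. Let $J$ be the complex structure of $h$ and the orientation, and for $\theta\in\mathbb R$ let $$L_\theta(h,h^\star)=\bigl(h(\beta_\theta\,\cdot,\beta_\theta\,\cdot),\,h(\beta_{\theta+\pi}\,\cdot,\beta_{\theta+\pi}\,\cdot)\bigr),\qquad \beta_\theta=\cos(\theta/2)\,E+\sin(\theta/2)\,Jb .$$ Fix $s>0$. A surface attached to a pair $(k,k^\star)$ of metrics on $M$ is an immersion $f:\widetilde M\to\mathbb H^3$ with unit normal $n$, of constant Gaussian curvature $K=-1/\cosh^2(s/2)$, whose fundamental forms $\mathrm I=\langle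 df,df\rangle$, $\mathrm{II}=\langle df,dn\rangle$, $\mathrm{III}=\langle dn,dn\rangle$ satisfy $\mathrm I=\cosh^2(s/2)\,k$ and $\mathrm{III}=\sinh^2(s/2)\,k^\star$ (lifted to $\widetilde M$), the normal being chosen such that $\mathrm{II}$ is positive definite. Let $(f,n)$ be the surface attached to $(h,h^\star)$, and let the sign of $b$ be fixed by requiring that the shape operator of $(f,n)$ is $B=-\tanh(s/2)\,b$, where $\mathrm{II}(u,v)=\mathrm I(u,Bv)$. Let $z$ be a positively oriented complex coordinate for the conformal class of $\mathrm{II}$ and write $\mathrm I=Q\,dz^2+R\,dz\,d\bar z+\bar Q\,d\bar z^2$. For $\mu\in S^1$ the member $f^\mu$ of the associated family of $f$ is the surface in $\mathbb H^3$ with fundamental forms $$\mathrm I^\mu=\mu^{-2}Q\,dz^2+R\,dz\,d\bar z+\mu^{2}\bar Q\,d\bar z^2,\qquad \mathrm{II}^\mu=\mathrm{II},\qquad \mathrm{III}^\mu=\tanh^2(s/2)\bigl(-\mu^{-2}Q\,dz^2+R\,dz\,d\bar z-\mu^{2}\bar Q\,d\bar z^2\bigr).$$ Then for every $s>0$, every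 $\theta\in\mathbb R$ and every square root $\sqrt\lambda\in S^1$ of $\lambda=e^{i\theta}$, the surface $\tilde f_\theta$ attached to $L_\theta(h,h^\star)$ coincides with $f^{\sqrt\lambda}$. That is: a surface with unit normal is attached to $L_\theta(h,h^\star)$ if and only if it is a member $f^{\sqrt\lambda}$ of the associated family; and any surface $\tilde f_\theta$ attached to $L_\theta(h,h^\star)$ and any $f^{\sqrt\lambda}$ differ, together with their unit normals, by an isometry of $\mathbb H^3$, and are equal if their positions, differentials and unit normals agree at one point. -/

import Mathlib

open scoped Manifold ContDiff

noncomputable section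

namespace Landslide

/-! ### Surfaces: metrics, orientation, complex structures -/

/-- Smooth Riemannian metrics on a smooth surface `M`. -/
abbrev SurfaceMetric (M : Type*) [TopologicalSpace M] [ChartedSpace (EuclideanSpace ℝ (Fin 2)) M]
    [IsManifold (𝓡 2) ∞ M] :=
  Bundle.ContMDiffRiemannianMetric (𝓡 2) ∞ (EuclideanSpace ℝ (Fin 2))
    (fun x : M => TangentSpace (𝓡 2) x)

/-- An orientation of a smooth surface, given by a nowhere vanishing smooth `2`-form:
a basis `(u, v)` of a tangent space is positive when the form is positive on it. -/
structure OrientationForm (M : Type*) [TopologicalSpace M]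
    [ChartedSpace (EuclideanSpace ℝ (Fin 2)) M] [IsManifold (𝓡 2) ∞ M] where
  /-- the value of the `2`-form at a point -/
  form (x : M) : TangentSpace (𝓡 2) x →L[ℝ] TangentSpace (𝓡 2) x →L[ℝ] ℝ
  alternating (x : M) (u : TangentSpace (𝓡 2) x) : form x u u = 0
  nonvanishing (x : M) : form x ≠ 0
  contMDiff : ContMDiff (𝓡 2)
    ((𝓡 2).prod 𝓘(ℝ, EuclideanSpace ℝ (Fin 2) →L[ℝ] EuclideanSpace ℝ (Fin 2) →L[ℝ] ℝ)) ∞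
    (fun x => Bundle.TotalSpace.mk' (EuclideanSpace ℝ (Fin 2) →L[ℝ] EuclideanSpace ℝ (Fin 2) →L[ℝ] ℝ)
      (E := fun x : M => TangentSpace (𝓡 2) x →L[ℝ] TangentSpace (𝓡 2) x →L[ℝ] ℝ) x (form x))

/-- `J` is the complex structure of an oriented Euclidean plane `(V, g, area)`: the `g`-isometry
with `J² = -1` for which `(u, J u)` is a positive basis for every `u ≠ 0`, i.e. the rotation by
`π / 2`. Here `g` is an inner product on the plane `V` and `area` a nonzero alternating form. -/
structure IsComplexStructure {V : Type*} [AddCommGroup V] [Module ℝ V]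
    (g area : V → V → ℝ) (J : V →ₗ[ℝ] V) : Prop where
  sq (u : V) : J (J u) = -u
  isometry (u v : V) : g (J u) (J v) = g u v
  positive (u : V) (hu : u ≠ 0) : 0 < area u (J u)

/-- Complex bilinear extension of a real bilinear form `g`: its value on `a + √-1 b` and
`c + √-1 d`. -/
def cExt {V : Type*} (g : V → V → ℝ) (a b c d : V) : ℂ :=
  ((g a c - g b d : ℝ) : ℂ) + Complex.I * ((g a d + g b c : ℝ) : ℂ)

/-- The `(2,0)`-part of the real symmetric bilinear form `g` with respect to the complex
structure `i`, that is `g(u', v')` where `u' = (u - √-1 i u) / 2` is the `(1,0)`-part of `u`.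
In a complex coordinate `z` it is `g(∂_z, ∂_z) dz²`. -/
def part20 {V : Type*} [AddCommGroup V] [Module ℝ V] (g : V → V → ℝ) (i : V → V) (u v : V) : ℂ :=
  cExt g ((1 / 2 : ℝ) • u) (-(1 / 2 : ℝ) • i u) ((1 / 2 : ℝ) • v) (-(1 / 2 : ℝ) • i v)

/-- The `(1,1)`-part `g(u', v'') + g(u'', v') = 2 Re g(u', v'')` of the real symmetric bilinear
form `g` with respect to the complex structure `i`, where `u''` is the conjugate of the
`(1,0)`-part `u'`. In a complex coordinate `z` it is `2 g(∂_z, ∂_zbar) dz dzbar`. -/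
def part11 {V : Type*} [AddCommGroup V] [Module ℝ V] (g : V → V → ℝ) (i : V → V) (u v : V) : ℝ :=
  2 * (cExt g ((1 / 2 : ℝ) • u) (-(1 / 2 : ℝ) • i u)
    ((1 / 2 : ℝ) • v) ((1 / 2 : ℝ) • i v)).re

section Teichmueller

variable {M : Type*} [TopologicalSpace M] [ChartedSpace (EuclideanSpace ℝ (Fin 2)) M]
  [IsManifold (𝓡 2) ∞ M]

/-- The derivative of a real function on a surface. -/
def dReal (a : M → ℝ) (x : M) (u : TangentSpace (𝓡 2) x) : ℝ :=
  mfderiv (𝓡 2) 𝓘(ℝ, ℝ) a x u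

/-- A Riemannian metric on a surface is hyperbolic when it is locally isometric to the upper half
plane `{(a, b) | 0 < b}` with the metric `(da² + db²) / b²`. -/
def IsHyperbolic (h : SurfaceMetric M) : Prop :=
  ∀ x₀ : M, ∃ U : Set M, IsOpen U ∧ x₀ ∈ U ∧ ∃ a b : M → ℝ,
    ContMDiffOn (𝓡 2) 𝓘(ℝ, ℝ) ∞ a U ∧ ContMDiffOn (𝓡 2) 𝓘(ℝ, ℝ) ∞ b U ∧
    ∀ x ∈ U, 0 < b x ∧ ∀ u v : TangentSpace (𝓡 2) x,
      h.inner x u v =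
        (dReal a x u * dReal a x v + dReal b x u * dReal b x v) / b x ^ 2

/-- The diffeomorphism `φ` is (smoothly) isotopic to the identity. -/
def IsIsotopicToId (φ : Diffeomorph (𝓡 2) (𝓡 2) M M ∞) : Prop :=
  ∃ H : ℝ → Diffeomorph (𝓡 2) (𝓡 2) M M ∞,
    ContMDiff (𝓘(ℝ, ℝ).prod (𝓡 2)) (𝓡 2) ∞ (fun q : ℝ × M => H q.1 q.2) ∧
    (∀ x, H 0 x = x) ∧ ∀ x, H 1 x = φ x

/-- `nabla` is the Levi-Civita connection of `h`: it is torsion free and metric.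
(`nabla Y x w` is the covariant derivative of `Y` at `x` in the direction `w`.) -/
structure IsLeviCivita (h : SurfaceMetric M)
    (nabla : CovariantDerivative (𝓡 2) (EuclideanSpace ℝ (Fin 2))
      (fun x : M => TangentSpace (𝓡 2) x)) : Prop where
  torsion_free (X Y : Π x : M, TangentSpace (𝓡 2) x) (x : M)
    (hX : MDifferentiableAt (𝓡 2) (𝓡 2).tangent
      (fun y => (⟨y, X y⟩ : TangentBundle (𝓡 2) M)) x)
    (hY : MDifferentiableAt (𝓡 2) (𝓡 2).tangent
      (fun y => (⟨y, Y y⟩ : TangentBundle (𝓡 2) M)) x) :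
    nabla Y x (X x) - nabla X x (Y x) = VectorField.mlieBracket (𝓡 2) X Y x
  metric (X Y : Π x : M, TangentSpace (𝓡 2) x) (x : M) (w : TangentSpace (𝓡 2) x)
    (hX : MDifferentiableAt (𝓡 2) (𝓡 2).tangent
      (fun y => (⟨y, X y⟩ : TangentBundle (𝓡 2) M)) x)
    (hY : MDifferentiableAt (𝓡 2) (𝓡 2).tangent
      (fun y => (⟨y, Y y⟩ : TangentBundle (𝓡 2) M)) x) :
    dReal (fun y => h.inner y (X y) (Y y)) x w
      = h.inner x (nabla X x w) (Y x) + h.inner x (X x) (nabla Y x w)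

/-- `b` is a Labourie operator of the pair `(h, hstar)` of metrics: it is a smooth `h`-self-adjoint
bundle morphism of determinant `1` satisfying the Codazzi equation
`∇_X (b Y) - ∇_Y (b X) = b [X, Y]`, and `h(b ·, b ·)` is isometric to `hstar` by a diffeomorphism
isotopic to the identity. These conditions determine `b` up to sign. -/
structure IsLabourie (h hstar : SurfaceMetric M)
    (b : Π x : M, TangentSpace (𝓡 2) x →L[ℝ] TangentSpace (𝓡 2) x) : Prop where
  contMDiff : ContMDiff (𝓡 2)
    ((𝓡 2).prod 𝓘(ℝ, EuclideanSpace ℝ (Fin 2) →L[ℝ] EuclideanSpace ℝ (Fin 2))) ∞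
    (fun x => Bundle.TotalSpace.mk' (EuclideanSpace ℝ (Fin 2) →L[ℝ] EuclideanSpace ℝ (Fin 2))
      (E := fun x : M => TangentSpace (𝓡 2) x →L[ℝ] TangentSpace (𝓡 2) x) x (b x))
  self_adjoint (x : M) (u v : TangentSpace (𝓡 2) x) : h.inner x (b x u) v = h.inner x u (b x v)
  det_eq_one (x : M) : LinearMap.det (b x : TangentSpace (𝓡 2) x →ₗ[ℝ] TangentSpace (𝓡 2) x) = 1
  codazzi : ∃ nabla : CovariantDerivative (𝓡 2) (EuclideanSpace ℝ (Fin 2))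
      (fun x : M => TangentSpace (𝓡 2) x), IsLeviCivita h nabla ∧
    ∀ (X Y : Π x : M, TangentSpace (𝓡 2) x) (x : M),
      MDifferentiableAt (𝓡 2) (𝓡 2).tangent (fun y => (⟨y, X y⟩ : TangentBundle (𝓡 2) M)) x →
      MDifferentiableAt (𝓡 2) (𝓡 2).tangent (fun y => (⟨y, Y y⟩ : TangentBundle (𝓡 2) M)) x →
      nabla (fun y => b y (Y y)) x (X x) - nabla (fun y => b y (X y)) x (Y x)
        = b x (VectorField.mlieBracket (𝓡 2) X Y x)
  isotopic : ∃ φ : Diffeomorph (𝓡 2) (𝓡 2) M M ∞, IsIsotopicToId φ ∧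
    ∀ (x : M) (u v : TangentSpace (𝓡 2) x),
      h.inner x (b x u) (b x v)
        = hstar.inner (φ x) (mfderiv (𝓡 2) (𝓡 2) φ x u) (mfderiv (𝓡 2) (𝓡 2) φ x v)

/-- The operator `β_θ = cos (θ / 2) E + sin (θ / 2) J b`. -/
def beta (J : Π x : M, TangentSpace (𝓡 2) x →ₗ[ℝ] TangentSpace (𝓡 2) x)
    (b : Π x : M, TangentSpace (𝓡 2) x →L[ℝ] TangentSpace (𝓡 2) x) (θ : ℝ)
    (x : M) (u : TangentSpace (𝓡 2) x) : TangentSpace (𝓡 2) x :=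
  Real.cos (θ / 2) • u + Real.sin (θ / 2) • J x (b x u)

/-- The metric `h(β_θ ·, β_θ ·)`. -/
def landslideMetric (h : SurfaceMetric M)
    (J : Π x : M, TangentSpace (𝓡 2) x →ₗ[ℝ] TangentSpace (𝓡 2) x)
    (b : Π x : M, TangentSpace (𝓡 2) x →L[ℝ] TangentSpace (𝓡 2) x) (θ : ℝ)
    (x : M) (u v : TangentSpace (𝓡 2) x) : ℝ :=
  h.inner x (beta J b θ x u) (beta J b θ x v)

/-- The landslide `L_θ(h, hstar) = (h(β_θ ·, β_θ ·), h(β_{θ+π} ·, β_{θ+π} ·))`,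
where `b` is the Labourie operator of the pair. -/
def landslide (h : SurfaceMetric M)
    (J : Π x : M, TangentSpace (𝓡 2) x →ₗ[ℝ] TangentSpace (𝓡 2) x)
    (b : Π x : M, TangentSpace (𝓡 2) x →L[ℝ] TangentSpace (𝓡 2) x) (θ : ℝ) :
    (Π x : M, TangentSpace (𝓡 2) x → TangentSpace (𝓡 2) x → ℝ) ×
      (Π x : M, TangentSpace (𝓡 2) x → TangentSpace (𝓡 2) x → ℝ) :=
  (landslideMetric h J b θ, landslideMetric h J b (θ + Real.pi))

end Teichmueller

/-! ### Surfaces in hyperbolic three-space -/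

/-- The inner product `-ξ₀η₀ + ξ₁η₁ + ξ₂η₂ + ξ₃η₃` of Minkowski space. Under the identification of
`ξ` with the Hermitian matrix `!![ξ₀ + ξ₁, ξ₃ - √-1 ξ₂; ξ₃ + √-1 ξ₂, ξ₀ - ξ₁]` the value on
`(ξ, ξ)` is minus the determinant and `2 ξ₀` is the trace. -/
def mink (ξ η : Fin 4 → ℝ) : ℝ := -(ξ 0 * η 0) + ξ 1 * η 1 + ξ 2 * η 2 + ξ 3 * η 3

/-- Hyperbolic three-space: determinant `1` and positive trace. -/
def hyp3 : Set (Fin 4 → ℝ) := {ξ | mink ξ ξ = -1 ∧ 0 < ξ 0}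

/-- The isometries of hyperbolic three-space: the linear maps of Minkowski space that preserve the
inner product and `hyp3`. -/
def IsHypIsometry (Φ : (Fin 4 → ℝ) →ₗ[ℝ] (Fin 4 → ℝ)) : Prop :=
  (∀ ξ η, mink (Φ ξ) (Φ η) = mink ξ η) ∧ ∀ ξ ∈ hyp3, Φ ξ ∈ hyp3

section Immersed

variable {N : Type*} [TopologicalSpace N] [ChartedSpace (EuclideanSpace ℝ (Fin 2)) N]

/-- The derivative of a map from a surface to Minkowski space. -/
def dMap (f : N → Fin 4 → ℝ) (x : N) (u : TangentSpace (𝓡 2) x) : Fin 4 → ℝ :=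
  mfderiv (𝓡 2) 𝓘(ℝ, Fin 4 → ℝ) f x u

/-- `f` is an immersed surface in hyperbolic three-space and `n` is a unit normal of it. -/
structure IsSurface (f n : N → Fin 4 → ℝ) : Prop where
  smooth : ContMDiff (𝓡 2) 𝓘(ℝ, Fin 4 → ℝ) ∞ f
  smooth_normal : ContMDiff (𝓡 2) 𝓘(ℝ, Fin 4 → ℝ) ∞ n
  mem_hyp3 (x : N) : f x ∈ hyp3
  immersion (x : N) : Function.Injective (dMap f x)
  normal_tangent (x : N) : mink (f x) (n x) = 0
  normal_unit (x : N) : mink (n x) (n x) = 1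
  normal_perp (x : N) (u : TangentSpace (𝓡 2) x) : mink (dMap f x u) (n x) = 0

/-- First fundamental form `⟨df, df⟩`. -/
def firstForm (f : N → Fin 4 → ℝ) (x : N) (u v : TangentSpace (𝓡 2) x) : ℝ :=
  mink (dMap f x u) (dMap f x v)

/-- Second fundamental form `⟨df, dn⟩`. -/
def secondForm (f n : N → Fin 4 → ℝ) (x : N) (u v : TangentSpace (𝓡 2) x) : ℝ :=
  mink (dMap f x u) (dMap n x v)

/-- Third fundamental form `⟨dn, dn⟩`. -/
def thirdForm (n : N → Fin 4 → ℝ) (x : N) (u v : TangentSpace (𝓡 2) x) : ℝ :=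
  mink (dMap n x u) (dMap n x v)

/-- The surface has constant Gaussian curvature `K`. By the Gauss equation `K = -1 + det B` with
`B` the shape operator, and `det B` is the quotient of the determinants of the second and the first
fundamental form. -/
def HasGaussCurvature (f n : N → Fin 4 → ℝ) (K : ℝ) : Prop :=
  ∀ (x : N) (u v : TangentSpace (𝓡 2) x),
    secondForm f n x u u * secondForm f n x v v - secondForm f n x u v * secondForm f n x v u
      = (K + 1) * (firstForm f x u u * firstForm f x v v - firstForm f x u v * firstForm f x v u)

/-- The associated family: `(g, ν)` is the member with spectral parameter `μ ∈ S¹` of the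
associated family of the surface `(f, n)` with constant Gaussian curvature `-1 / cosh² (s / 2)`,
where `i` is the complex structure of the second fundamental form of `(f, n)`.
With `Q dz²` the `(2,0)`-part and `R` the `(1,1)`-part of the first fundamental form of `f`, and
with `σ = tanh (s / 2)`, the fundamental forms of `(g, ν)` are
`I = μ⁻² Q dz² + R + conj (μ⁻² Q dz²)`, `II = II_f`, and
`III = σ² (-μ⁻² Q dz² + R - conj (μ⁻² Q dz²))`. These determine `g` up to isometry. -/
structure IsAssociated (s : ℝ)
    (i : Π x : N, TangentSpace (𝓡 2) x →ₗ[ℝ] TangentSpace (𝓡 2) x)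
    (f n : N → Fin 4 → ℝ) (μ : Circle) (g ν : N → Fin 4 → ℝ) : Prop where
  surface : IsSurface g ν
  first (x : N) (u v : TangentSpace (𝓡 2) x) :
    firstForm g x u v =
      2 * ((μ : ℂ) ^ (-2 : ℤ) * part20 (firstForm f x) (i x) u v).re
        + part11 (firstForm f x) (i x) u v
  second (x : N) (u v : TangentSpace (𝓡 2) x) : secondForm g ν x u v = secondForm f n x u v
  third (x : N) (u v : TangentSpace (𝓡 2) x) :
    thirdForm ν x u v =
      Real.tanh (s / 2) ^ 2 *
        (-(2 * ((μ : ℂ) ^ (-2 : ℤ) * part20 (firstForm f x) (i x) u v).re)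
          + part11 (firstForm f x) (i x) u v)

variable {M : Type*} [TopologicalSpace M] [ChartedSpace (EuclideanSpace ℝ (Fin 2)) M]

/-- `p : N → M` is the universal covering of the surface `M`. -/
structure IsUniversalCovering (p : N → M) : Prop where
  simply_connected : SimplyConnectedSpace N
  covering : IsCoveringMap p
  local_diffeo : IsLocalDiffeomorph (𝓡 2) (𝓡 2) ∞ p

/-- The pull-back to `N` of a field `k` of bilinear forms on `M`. -/
def pullForm (p : N → M) (k : Π y : M, TangentSpace (𝓡 2) y → TangentSpace (𝓡 2) y → ℝ)
    (x : N) (u v : TangentSpace (𝓡 2) x) : ℝ :=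
  k (p x) (mfderiv (𝓡 2) (𝓡 2) p x u) (mfderiv (𝓡 2) (𝓡 2) p x v)

/-- `f`, with unit normal `n`, is the surface attached to the pair `k = (k.1, k.2)` of metrics
of `M`: it is a surface of constant Gaussian curvature `-1 / cosh² (s / 2)`, defined on the
universal covering, with `I = cosh² (s / 2) k.1` and `III = sinh² (s / 2) k.2`, the unit normal
being the one for which the second fundamental form is a Riemannian metric. -/
structure IsAttached (p : N → M) (s : ℝ)
    (k : (Π y : M, TangentSpace (𝓡 2) y → TangentSpace (𝓡 2) y → ℝ) ×
      (Π y : M, TangentSpace (𝓡 2) y → TangentSpace (𝓡 2) y → ℝ))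
    (f n : N → Fin 4 → ℝ) : Prop where
  surface : IsSurface f n
  curvature : HasGaussCurvature f n (-1 / Real.cosh (s / 2) ^ 2)
  first (x : N) (u v : TangentSpace (𝓡 2) x) :
    firstForm f x u v = Real.cosh (s / 2) ^ 2 * pullForm p k.1 x u v
  third (x : N) (u v : TangentSpace (𝓡 2) x) :
    thirdForm n x u v = Real.sinh (s / 2) ^ 2 * pullForm p k.2 x u v
  second_pos (x : N) (u : TangentSpace (𝓡 2) x) (hu : u ≠ 0) : 0 < secondForm f n x u u

/-- The shape operator of `(f, n)` is (the lift to the universal covering of) the bundle morphism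
`B` of `TM`, i.e. `II(u, v) = I(u, B v)`. -/
def HasShapeOperator (p : N → M)
    (B : Π y : M, TangentSpace (𝓡 2) y → TangentSpace (𝓡 2) y) (f n : N → Fin 4 → ℝ) : Prop :=
  ∀ (x : N) (u v w : TangentSpace (𝓡 2) x),
    mfderiv (𝓡 2) (𝓡 2) p x w = B (p x) (mfderiv (𝓡 2) (𝓡 2) p x v) →
    secondForm f n x u v = firstForm f x u w

end Immersed

end Landslide

end

open Landslide

/-! Put `K = J b`. Since `b` is self-adjoint of determinant one on a plane, `b J b = J` (`b_J_b`),
hence `K² = -1`. The second fundamental form of `f` is a negative multiple of `h(·, b ·)`, and its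
complex structure is `i = -K` (`complexStructure_eq`). So `β_θ = cos (θ/2) + sin (θ/2) K` is
multiplication by `e^{-√-1 θ/2}` for `i`. Pulling back `I` by it multiplies `Q dz²` by `e^{-√-1 θ} =
μ⁻²` and leaves the `(1,1)`-part alone; the further quarter turn in `β_{θ+π}` changes the sign of
the `(2,0)`-part, which gives `III`. Thus the first and third forms of the landslide and of the
associated family agree (`associated_first`, `associated_third`).

The remaining datum is `II`. A surface attached to the landslide is prescribed through `I`, `III`
and its curvature. These fix `B²` and `det B` of the shape operator, and a positive self-adjoint `B`
is the unique positive square root of `B²` (`IsSecondForm.unique`). The form `II` of `f` is a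
solution for every `θ` (`IsLabouriePlane.isSecondForm`), because rotations for `i` preserve it; so
it is the second form of the attached surface. The same fact supplies the curvature in the converse
direction.

Congruence is the uniqueness half of the fundamental theorem of surfaces. The linear map of
Minkowski space carrying one moving frame to the other has zero derivative in a chart, because the
structure equations involve only `I` and `II`. The local congruences are then glued over the
connected surface `N`. -/

noncomputable section

namespace Landslide

/-! ### Linear algebra of an oriented Euclidean plane with a unimodular self-adjoint operator -/

/-- An oriented Euclidean plane `(V, h, area)` with complex structure `J` and a self-adjoint
operator `b` of determinant one. -/
structure IsLabouriePlane {V : Type*} [AddCommGroup V] [Module ℝ V]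
    (h area : V →ₗ[ℝ] V →ₗ[ℝ] ℝ) (J b : V →ₗ[ℝ] V) : Prop where
  finrank : Module.finrank ℝ V = 2
  symm (u v : V) : h u v = h v u
  pos (u : V) (hu : u ≠ 0) : 0 < h u u
  alternating (u : V) : area u u = 0
  complex : IsComplexStructure (fun u v => h u v) (fun u v => area u v) J
  self_adjoint (u v : V) : h (b u) v = h u (b v)
  det_eq_one : LinearMap.det b = 1

namespace IsLabouriePlane

variable {V : Type*} [AddCommGroup V] [Module ℝ V]
  {h area : V →ₗ[ℝ] V →ₗ[ℝ] ℝ} {J b : V →ₗ[ℝ] V}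

section
variable (P : IsLabouriePlane h area J b)
include P

lemma J_skew (u v : V) : h (J u) v = -h u (J v) := by
  have := P.complex.isometry u (J v)
  simp only [P.complex.sq, map_neg] at this
  linarith

lemma J_self (u : V) : h u (J u) = 0 := by
  have h1 := P.J_skew u u
  have h2 := P.symm (J u) u
  linarith

/-- Normalise any nonzero vector and rotate it by `J`: the coordinates in this orthonormal frame are
inner products, which turns the identities below into polynomial ones. -/
lemma exists_frame : ∃ e : V, h e e = 1 ∧ ∀ u, u = h e u • e + h (J e) u • J e := by
  have : Nontrivial V := Module.nontrivial_of_finrank_pos (R := ℝ) (by rw [P.finrank]; norm_num)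
  obtain ⟨a, ha⟩ := exists_ne (0 : V)
  have ha0 := P.pos a ha
  set r := Real.sqrt (h a a) with hr
  have hr0 : 0 < r := Real.sqrt_pos.2 ha0
  have hrr : r * r = h a a := Real.mul_self_sqrt ha0.le
  refine ⟨r⁻¹ • a, ?_, ?_⟩
  · simp only [map_smul, LinearMap.smul_apply, smul_eq_mul, ← hrr]
    field_simp
  set e := r⁻¹ • a with he
  have hee : h e e = 1 := by
    simp only [he, map_smul, LinearMap.smul_apply, smul_eq_mul, ← hrr]
    field_simp
  have hJJ : h (J e) (J e) = 1 := (P.complex.isometry e e).trans hee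
  have hJe : h (J e) e = 0 := by rw [P.symm, P.J_self]
  have hli : LinearIndependent ℝ ![e, J e] := by
    rw [LinearIndependent.pair_iff]
    intro x y hxy
    constructor
    · have := congrArg (h e) hxy
      simpa [hee, P.J_self] using this
    · have := congrArg (h (J e)) hxy
      simpa [hJJ, hJe] using this
  intro u
  let B := basisOfLinearIndependentOfCardEqFinrank hli (by simp [P.finrank])
  have hu := B.sum_repr u
  have hB0 : B 0 = e := by simp [B]
  have hB1 : B 1 = J e := by simp [B]
  rw [Fin.sum_univ_two, hB0, hB1] at hu
  have h0 : h e u = B.repr u 0 := by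
    conv_lhs => rw [← hu]
    simp [hee, P.J_self]
  have h1 : h (J e) u = B.repr u 1 := by
    conv_lhs => rw [← hu]
    simp [hJJ, hJe]
  rw [h0, h1, hu]

omit P in
lemma inner_eq_frame {e : V} (he : ∀ u, u = h e u • e + h (J e) u • J e) (u v : V) :
    h u v = h e u * h e v + h (J e) u * h (J e) v := by
  conv_lhs => rw [he u]
  simp

/-- The form `h(·, J ·)` is the Euclidean area up to sign, and the sign cancels in the product of
two areas. -/
lemma binet_cauchy (a b' c d : V) :
    h a c * h b' d - h a d * h b' c = h a (J b') * h c (J d) := by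
  obtain ⟨e, hee, he⟩ := P.exists_frame
  have h1 (u : V) : h e (J u) = -h (J e) u := by rw [P.J_skew, neg_neg]
  have h2 (u : V) : h (J e) (J u) = h e u := P.complex.isometry e u
  rw [inner_eq_frame he a c, inner_eq_frame he b' d, inner_eq_frame he a d,
    inner_eq_frame he b' c, inner_eq_frame he a (J b'), inner_eq_frame he c (J d),
    h1, h1, h2, h2]
  ring

/-- An operator scales the area form `h(·, J ·)` by its determinant, here one; self-adjointness
moves one factor `b` across `h`. -/
lemma b_J_b (u : V) : b (J (b u)) = J u := by
  obtain ⟨e, hee, he⟩ := P.exists_frame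
  have hJe : h (J e) e = 0 := by rw [P.symm, P.J_self]
  have hJJ : h (J e) (J e) = 1 := (P.complex.isometry e e).trans hee
  have hq : h (J e) (b e) = h e (b (J e)) := by rw [P.symm, P.self_adjoint]
  have hli : LinearIndependent ℝ ![e, J e] := by
    rw [LinearIndependent.pair_iff]
    intro x y hxy
    constructor
    · have := congrArg (h e) hxy
      simpa [hee, P.J_self] using this
    · have := congrArg (h (J e)) hxy
      simpa [hJJ, hJe] using this
  let B := basisOfLinearIndependentOfCardEqFinrank hli (by simp [P.finrank])
  have hB0 : B 0 = e := by simp [B]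
  have hB1 : B 1 = J e := by simp [B]
  have hr (v : V) : B.repr v = Finsupp.equivFunOnFinite.symm ![h e v, h (J e) v] := by
    apply B.repr.symm.injective
    rw [LinearEquiv.symm_apply_apply, B.repr_symm_apply, Finsupp.linearCombination_apply,
      Finsupp.sum_fintype _ _ (by simp), Fin.sum_univ_two, hB0, hB1]
    exact he v
  have hdet : h e (b e) * h (J e) (b (J e)) - h e (b (J e)) * h e (b (J e)) = 1 := by
    have := P.det_eq_one
    rw [← LinearMap.det_toMatrix B, Matrix.det_fin_two] at this
    simp only [LinearMap.toMatrix_apply, hB0, hB1, hr] at this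
    simp [hq] at this
    exact this
  set x := h e (b e)
  set y := h e (b (J e))
  set z := h (J e) (b (J e))
  have hbe : b e = x • e + y • J e := by rw [he (b e), hq]
  have hbJ : b (J e) = y • e + z • J e := he _
  rw [he u]
  simp only [map_add, map_smul, hbe, hbJ, P.complex.sq, map_neg]
  have hz : z * x = 1 + y * y := by linarith
  generalize h e u = α
  generalize h (J e) u = β
  match_scalars
  · linear_combination (-β) * hdet
  · linear_combination α * hdet

/-- Alternating forms on a plane form a line, so the orientation form enters only through its sign.
-/
lemma area_J : ∃ t : ℝ, 0 < t ∧ ∀ u v, area u (J v) = t * h u v := by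
  obtain ⟨e, hee, he⟩ := P.exists_frame
  have he0 : e ≠ 0 := by rintro rfl; simp at hee
  have hJ (v : V) : J v = h e v • J e - h (J e) v • e := by
    conv_lhs => rw [he v]
    simp only [map_add, map_smul, P.complex.sq, smul_neg, sub_eq_add_neg]
  have hs : area (J e) e = -area e (J e) := by
    have := P.alternating (e + J e)
    simp only [map_add, LinearMap.add_apply, P.alternating] at this
    linarith
  refine ⟨area e (J e), P.complex.positive e he0, fun u v => ?_⟩
  rw [hJ v, inner_eq_frame he u v]
  generalize h e v = x
  generalize h (J e) v = y
  conv_lhs => rw [he u]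
  simp only [map_add, map_sub, map_smul, LinearMap.add_apply, LinearMap.smul_apply,
    P.alternating, hs, smul_eq_mul]
  ring

/-- This makes `J b` a complex structure, the fact on which the whole landslide rests. -/
lemma sq (u : V) : J (b (J (b u))) = -u := by rw [P.b_J_b, P.complex.sq]

lemma inner_b_comm (u v : V) : h u (b v) = h v (b u) := by rw [← P.self_adjoint, P.symm]

lemma gram_b (u v : V) :
    h u (b u) * h v (b v) - h u (b v) * h v (b u) = h u (J v) ^ 2 := by
  rw [P.binet_cauchy, P.self_adjoint, P.b_J_b]
  ring

lemma gram (u v : V) : h u u * h v v - h u v * h v u = h u (J v) ^ 2 := by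
  rw [P.binet_cauchy]
  ring

/-- Uniqueness of the complex structure: the one of the metric `-h(·, b ·)` is `-J b`. -/
lemma eq_of_isComplexStructure (hbpos : ∀ u, u ≠ 0 → h u (b u) < 0) {u v : V}
    (huv : h u (b v) = 0) (hnorm : h v (b v) = h u (b u)) (hpos : 0 < area u v) :
    v = -J (b u) := by
  obtain ⟨t, ht, harea⟩ := P.area_J
  have hu : u ≠ 0 := by rintro rfl; simp at hpos
  have h1 : h u (J v) < 0 := by
    have := harea u (J v)
    rw [P.complex.sq, map_neg] at this
    nlinarith
  -- The Gram determinants determine `h u (J v)` up to sign; orientation selects the negative value.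
  have h2 : h u (J v) = h u (b u) := by
    have := P.gram_b u v
    rw [hnorm, huv] at this
    have h3 := hbpos u hu
    have h4 : (h u (b u) - h u (J v)) * (h u (b u) + h u (J v)) = 0 := by linear_combination this
    rcases mul_eq_zero.1 h4 with h5 | h5 <;> linarith
  rw [eq_neg_iff_add_eq_zero]
  -- The definite form `h(·, b ·)` vanishes on `v + J (b u)`, so this vector is zero.
  by_contra hw
  have h3 := hbpos _ hw
  have h4 : h (J (b u)) (b v) = h v (J u) := by rw [P.inner_b_comm, P.b_J_b]
  have h5 : h (J (b u)) (J u) = h u (b u) := by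
    rw [P.symm]; exact P.complex.isometry u (b u)
  have h6 : h v (J u) = -h u (J v) := by rw [P.symm, P.J_skew]
  simp only [map_add, LinearMap.add_apply, P.b_J_b, h4, h5, h6, hnorm, h2] at h3
  linarith

/-! With `K = J b` the operators `c + σ K` for `c² + σ² = 1` are the rotations with respect to the
complex structure `-K`. -/

variable {c σ : ℝ} (hcs : c ^ 2 + σ ^ 2 = 1)

lemma inner_J_b_J (u v : V) : h (J (b u)) (J v) = h u (b v) := by
  rw [← P.self_adjoint]; exact P.complex.isometry (b u) v

include hcs in
-- The right side does not contain `c` and `σ`: this is the invariance of the second fundamental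
-- form under the landslide.
lemma inner_rotation_J (u v : V) :
    h (c • u + σ • J (b u)) (J (-σ • v + c • J (b v))) = -h u (b v) := by
  have h1 : h (J (b u)) (b v) = -h u (J v) := by
    rw [P.inner_b_comm, P.b_J_b, P.symm, P.J_skew]
  simp only [map_add, map_smul, LinearMap.add_apply, LinearMap.smul_apply, smul_eq_mul,
    P.complex.sq, map_neg, P.inner_J_b_J, h1]
  linear_combination (-h u (b v)) * hcs

include hcs in
-- The operator `c + σ J b` has determinant `c² + σ² = 1`, so it preserves area.
lemma rotation_inner_J (u v : V) :
    h (c • u + σ • J (b u)) (J (c • v + σ • J (b v))) = h u (J v) := by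
  have h1 : h (J (b u)) (b v) = -h u (J v) := by
    rw [P.inner_b_comm, P.b_J_b, P.symm, P.J_skew]
  simp only [map_add, map_smul, LinearMap.add_apply, LinearMap.smul_apply, smul_eq_mul,
    P.complex.sq, map_neg, P.inner_J_b_J, h1]
  linear_combination (h u (J v)) * hcs

include hcs in
lemma gram_rotation (u v : V) :
    h (c • u + σ • J (b u)) (c • u + σ • J (b u)) * h (c • v + σ • J (b v)) (c • v + σ • J (b v))
      - h (c • u + σ • J (b u)) (c • v + σ • J (b v))
        * h (c • v + σ • J (b v)) (c • u + σ • J (b u)) = h u (J v) ^ 2 := by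
  rw [P.gram, P.rotation_inner_J hcs]

include hcs in
lemma rotation_rotation (u : V) :
    c • (c • u - σ • J (b u)) + σ • J (b (c • u - σ • J (b u))) = u := by
  simp only [map_sub, map_smul, P.sq]
  match_scalars
  · linear_combination hcs
  · ring

end

end IsLabouriePlane

end Landslide

end

noncomputable section

namespace Landslide

/-! ### Minkowski space -/

lemma mink_comm (ξ η : Fin 4 → ℝ) : mink ξ η = mink η ξ := by simp only [mink]; ring

lemma mink_add_left (ξ ξ' η : Fin 4 → ℝ) : mink (ξ + ξ') η = mink ξ η + mink ξ' η := by
  simp only [mink, Pi.add_apply]; ring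

lemma mink_smul_left (a : ℝ) (ξ η : Fin 4 → ℝ) : mink (a • ξ) η = a * mink ξ η := by
  simp only [mink, Pi.smul_apply, smul_eq_mul]; ring

lemma mink_add_right (ξ η η' : Fin 4 → ℝ) : mink ξ (η + η') = mink ξ η + mink ξ η' := by
  simp only [mink, Pi.add_apply]; ring

lemma mink_smul_right (a : ℝ) (ξ η : Fin 4 → ℝ) : mink ξ (a • η) = a * mink ξ η := by
  simp only [mink, Pi.smul_apply, smul_eq_mul]; ring

lemma mink_zero_right (η : Fin 4 → ℝ) : mink η 0 = 0 := by simp [mink]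

lemma eq_of_forall_mink_eq {ξ η : Fin 4 → ℝ} (H : ∀ ζ, mink ζ ξ = mink ζ η) : ξ = η := by
  funext k
  have := H (Pi.single k 1)
  fin_cases k <;> simpa [mink] using this

/-- Reversed Cauchy–Schwarz: the spatial parts have norm strictly less than the time coordinates. -/
lemma mink_neg_of_mem_hyp3 {ξ η : Fin 4 → ℝ} (hξ : ξ ∈ hyp3) (hη : η ∈ hyp3) : mink ξ η < 0 := by
  obtain ⟨h1, h2⟩ := hξ
  obtain ⟨h3, h4⟩ := hη
  simp only [mink] at *
  by_contra! hc
  have h5 : (ξ 1 * η 1 + ξ 2 * η 2 + ξ 3 * η 3) ^ 2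
      ≤ (ξ 1 ^ 2 + ξ 2 ^ 2 + ξ 3 ^ 2) * (η 1 ^ 2 + η 2 ^ 2 + η 3 ^ 2) := by
    nlinarith [sq_nonneg (ξ 1 * η 2 - ξ 2 * η 1), sq_nonneg (ξ 1 * η 3 - ξ 3 * η 1),
      sq_nonneg (ξ 2 * η 3 - ξ 3 * η 2)]
  have h6 : (ξ 1 ^ 2 + ξ 2 ^ 2 + ξ 3 ^ 2) = ξ 0 ^ 2 - 1 := by linarith
  have h7 : (η 1 ^ 2 + η 2 ^ 2 + η 3 ^ 2) = η 0 ^ 2 - 1 := by linarith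
  rw [h6, h7] at h5
  have h8 : 0 < ξ 0 * η 0 := mul_pos h2 h4
  have h9 : (ξ 0 * η 0) ^ 2 ≤ (ξ 1 * η 1 + ξ 2 * η 2 + ξ 3 * η 3) ^ 2 :=
    pow_le_pow_left₀ h8.le (by linarith) 2
  nlinarith [sq_nonneg (ξ 1), sq_nonneg (ξ 2), sq_nonneg (ξ 3), sq_nonneg (η 1), sq_nonneg (η 2),
    sq_nonneg (η 3)]

/-- The alternative is that `-η` lies on the upper sheet, and then the product with `ξ` would have
the other sign. -/
lemma mem_hyp3_of_mink_neg {ξ η : Fin 4 → ℝ} (hξ : ξ ∈ hyp3) (hη : mink η η = -1)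
    (h : mink ξ η < 0) : η ∈ hyp3 := by
  refine ⟨hη, ?_⟩
  by_contra! h0
  rcases h0.eq_or_lt with h0 | h0
  · simp only [mink, h0] at hη
    nlinarith [sq_nonneg (η 1), sq_nonneg (η 2), sq_nonneg (η 3)]
  · have h1 : -η ∈ hyp3 := ⟨by simpa [mink] using hη, by simpa using h0⟩
    have h2 := mink_neg_of_mem_hyp3 hξ h1
    have h3 : mink ξ (-η) = -mink ξ η := by simp only [mink, Pi.neg_apply]; ring
    linarith

/-- A linear map preserving the Minkowski product and mapping one point of hyperbolic space to
hyperbolic space is an isometry of hyperbolic space. -/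
lemma isHypIsometry_of_apply_mem {Φ : (Fin 4 → ℝ) →ₗ[ℝ] (Fin 4 → ℝ)}
    (hΦ : ∀ ξ η, mink (Φ ξ) (Φ η) = mink ξ η) {ξ : Fin 4 → ℝ} (hξ : ξ ∈ hyp3)
    (hξ' : Φ ξ ∈ hyp3) : IsHypIsometry Φ := by
  refine ⟨hΦ, fun η hη => mem_hyp3_of_mink_neg hξ' ?_ ?_⟩
  · rw [hΦ]; exact hη.1
  · rw [hΦ]; exact mink_neg_of_mem_hyp3 hξ hη

lemma hasFDerivAt_mink {E : Type*} [NormedAddCommGroup E] [NormedSpace ℝ E]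
    {A B : E → Fin 4 → ℝ} {A' B' : E →L[ℝ] (Fin 4 → ℝ)} {x : E}
    (hA : HasFDerivAt A A' x) (hB : HasFDerivAt B B' x) :
    ∃ L : E →L[ℝ] ℝ, HasFDerivAt (fun y => mink (A y) (B y)) L x ∧
      ∀ w, L w = mink (A' w) (B x) + mink (A x) (B' w) := by
  have hA' := fun k => hasFDerivAt_pi'.1 hA k
  have hB' := fun k => hasFDerivAt_pi'.1 hB k
  refine ⟨_, ((((hA' 0).mul (hB' 0)).neg.add ((hA' 1).mul (hB' 1))).add
    ((hA' 2).mul (hB' 2))).add ((hA' 3).mul (hB' 3)), fun w => ?_⟩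
  simp [mink]
  ring

/-! ### Moving frames -/

/-- The linear map `(a, u, c) ↦ a ξ + L u + c η`. -/
def frameMap (ξ : Fin 4 → ℝ) (L : EuclideanSpace ℝ (Fin 2) →L[ℝ] (Fin 4 → ℝ)) (η : Fin 4 → ℝ) :
    (ℝ × EuclideanSpace ℝ (Fin 2) × ℝ) →L[ℝ] (Fin 4 → ℝ) :=
  (ContinuousLinearMap.fst ℝ ℝ (EuclideanSpace ℝ (Fin 2) × ℝ)).smulRight ξ
    + (L.comp ((ContinuousLinearMap.fst ℝ (EuclideanSpace ℝ (Fin 2)) ℝ).comp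
        (ContinuousLinearMap.snd ℝ ℝ (EuclideanSpace ℝ (Fin 2) × ℝ)))
      + ((ContinuousLinearMap.snd ℝ (EuclideanSpace ℝ (Fin 2)) ℝ).comp
        (ContinuousLinearMap.snd ℝ ℝ (EuclideanSpace ℝ (Fin 2) × ℝ))).smulRight η)

lemma frameMap_apply (ξ : Fin 4 → ℝ) (L : EuclideanSpace ℝ (Fin 2) →L[ℝ] (Fin 4 → ℝ))
    (η : Fin 4 → ℝ) (X : ℝ × EuclideanSpace ℝ (Fin 2) × ℝ) :
    frameMap ξ L η X = X.1 • ξ + (L X.2.1 + X.2.2 • η) := rfl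

/-- `(ξ, L, η)` are the position, the differential and the normal of an immersed surface in
hyperbolic space at some point. -/
structure IsAdaptedFrame (ξ : Fin 4 → ℝ) (L : EuclideanSpace ℝ (Fin 2) →L[ℝ] (Fin 4 → ℝ))
    (η : Fin 4 → ℝ) : Prop where
  norm_position : mink ξ ξ = -1
  position_tangent (u : EuclideanSpace ℝ (Fin 2)) : mink ξ (L u) = 0
  position_normal : mink ξ η = 0
  normal_tangent (u : EuclideanSpace ℝ (Fin 2)) : mink η (L u) = 0
  norm_normal : mink η η = 1
  injective : Function.Injective L

namespace IsAdaptedFrame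

variable {ξ η : Fin 4 → ℝ} {L : EuclideanSpace ℝ (Fin 2) →L[ℝ] (Fin 4 → ℝ)}
  (H : IsAdaptedFrame ξ L η)
include H

lemma mink_position (X : ℝ × EuclideanSpace ℝ (Fin 2) × ℝ) :
    mink ξ (frameMap ξ L η X) = -X.1 := by
  simp only [frameMap_apply, mink_add_right, mink_smul_right, H.norm_position, H.position_tangent,
    H.position_normal]
  ring

lemma mink_normal (X : ℝ × EuclideanSpace ℝ (Fin 2) × ℝ) :
    mink η (frameMap ξ L η X) = X.2.2 := by
  simp only [frameMap_apply, mink_add_right, mink_smul_right, mink_comm η ξ, H.norm_normal,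
    H.normal_tangent, H.position_normal]
  ring

lemma mink_frameMap (X Y : ℝ × EuclideanSpace ℝ (Fin 2) × ℝ) :
    mink (frameMap ξ L η X) (frameMap ξ L η Y)
      = -(X.1 * Y.1) + mink (L X.2.1) (L Y.2.1) + X.2.2 * Y.2.2 := by
  rw [frameMap_apply ξ L η X, mink_add_left, mink_add_left, mink_smul_left, mink_smul_left,
    H.mink_position, H.mink_normal]
  simp only [frameMap_apply, mink_add_right, mink_smul_right, mink_comm (L X.2.1) ξ,
    mink_comm (L X.2.1) η, H.position_tangent, H.normal_tangent]
  ring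

/-- Pairing with `ξ` and `η` recovers the outer coordinates, so only the injectivity of `L` is
needed; dimensions match as `1 + 2 + 1 = 4`. -/
lemma frameMap_bijective : Function.Bijective (frameMap ξ L η) := by
  have hinj : Function.Injective (frameMap ξ L η) := by
    rw [injective_iff_map_eq_zero]
    rintro ⟨a, u, c⟩ h
    have h1 := H.mink_position (a, u, c)
    have h2 := H.mink_normal (a, u, c)
    rw [h, mink_zero_right] at h1 h2
    have ha : a = 0 := by simpa using h1
    have hc : c = 0 := h2.symm
    subst ha hc
    simp only [frameMap_apply, zero_smul, zero_add, add_zero] at h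
    rw [H.injective (h.trans (map_zero L).symm)]
    rfl
  exact ⟨hinj, (LinearMap.injective_iff_surjective_of_finrank_eq_finrank
    (f := (frameMap ξ L η : (ℝ × EuclideanSpace ℝ (Fin 2) × ℝ) →ₗ[ℝ] (Fin 4 → ℝ)))
    (by simp)).1 hinj⟩

lemma exists_frame_eq (ζ : Fin 4 → ℝ) (h1 : mink ξ ζ = 0) (h2 : mink η ζ = 0) :
    ∃ u, ζ = L u := by
  obtain ⟨⟨a, u, c⟩, rfl⟩ := H.frameMap_bijective.2 ζ
  rw [H.mink_position] at h1
  rw [H.mink_normal] at h2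
  have ha : a = 0 := by simpa using h1
  have hc : c = 0 := h2
  subst ha hc
  exact ⟨u, by simp [frameMap_apply]⟩

lemma linearMap_ext {Φ Ψ : (Fin 4 → ℝ) →L[ℝ] (Fin 4 → ℝ)}
    (h1 : Φ ξ = Ψ ξ) (h2 : ∀ u, Φ (L u) = Ψ (L u)) (h3 : Φ η = Ψ η) : Φ = Ψ := by
  ext1 ζ
  obtain ⟨X, rfl⟩ := H.frameMap_bijective.2 ζ
  simp only [frameMap_apply, map_add, map_smul, h1, h2, h3]

end IsAdaptedFrame

end Landslide

end

noncomputable section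

namespace Landslide

/-! ### Rigidity of surfaces parametrized by plane domains -/

/-- The structure equations of an adapted frame `(ξ, L, η)` with derivative `(L, D, S)`: here `D` is
the second derivative of the position and `S` the derivative of the normal. -/
structure IsFrameDerivative (ξ : Fin 4 → ℝ) (L : EuclideanSpace ℝ (Fin 2) →L[ℝ] (Fin 4 → ℝ))
    (η : Fin 4 → ℝ)
    (D : EuclideanSpace ℝ (Fin 2) →L[ℝ] EuclideanSpace ℝ (Fin 2) →L[ℝ] (Fin 4 → ℝ))
    (S : EuclideanSpace ℝ (Fin 2) →L[ℝ] (Fin 4 → ℝ)) : Prop where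
  symm (u v : EuclideanSpace ℝ (Fin 2)) : D u v = D v u
  position_second (u v : EuclideanSpace ℝ (Fin 2)) : mink ξ (D u v) = -mink (L u) (L v)
  position_normal (u : EuclideanSpace ℝ (Fin 2)) : mink ξ (S u) = 0
  normal_second (u v : EuclideanSpace ℝ (Fin 2)) : mink η (D u v) = -mink (L v) (S u)
  normal_normal (u : EuclideanSpace ℝ (Fin 2)) : mink η (S u) = 0

lemma IsFrameDerivative.second_comm {ξ η : Fin 4 → ℝ}
    {L : EuclideanSpace ℝ (Fin 2) →L[ℝ] (Fin 4 → ℝ)}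
    {D : EuclideanSpace ℝ (Fin 2) →L[ℝ] EuclideanSpace ℝ (Fin 2) →L[ℝ] (Fin 4 → ℝ)}
    {S : EuclideanSpace ℝ (Fin 2) →L[ℝ] (Fin 4 → ℝ)} (H : IsFrameDerivative ξ L η D S)
    (u v : EuclideanSpace ℝ (Fin 2)) : mink (L u) (S v) = mink (L v) (S u) := by
  have h1 := H.normal_second v u
  rw [H.symm, H.normal_second] at h1
  linarith

/-- A surface parametrized by the plane domain `Ω`. -/
structure IsPlaneSurface (Ω : Set (EuclideanSpace ℝ (Fin 2)))
    (G ν : EuclideanSpace ℝ (Fin 2) → Fin 4 → ℝ) : Prop where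
  smooth : ContDiffOn ℝ ∞ G Ω
  smooth_normal : ContDiffOn ℝ ∞ ν Ω
  frame (y) (hy : y ∈ Ω) : IsAdaptedFrame (G y) (fderiv ℝ G y) (ν y)

lemma two_le_infty : (1 : WithTop ℕ∞) + 1 ≤ ∞ := by
  rw [one_add_one_eq_two]
  exact WithTop.coe_le_coe.2 (le_top : (2 : ℕ∞) ≤ ⊤)

lemma apply_eq_zero_of_eventually_const {E : Type*} [NormedAddCommGroup E] [NormedSpace ℝ E]
    {A B : E → Fin 4 → ℝ} {A' B' : E →L[ℝ] (Fin 4 → ℝ)} {x : E}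
    (hA : HasFDerivAt A A' x) (hB : HasFDerivAt B B' x) {c : ℝ}
    (hc : ∀ᶠ y in nhds x, mink (A y) (B y) = c) (w : E) :
    mink (A' w) (B x) + mink (A x) (B' w) = 0 := by
  obtain ⟨T, hT, hw⟩ := hasFDerivAt_mink hA hB
  have h0 : HasFDerivAt (fun y => mink (A y) (B y)) (0 : E →L[ℝ] ℝ) x :=
    (hasFDerivAt_const c x).congr_of_eventuallyEq hc
  rw [← hw, hT.unique h0]
  rfl

namespace IsPlaneSurface

variable {Ω : Set (EuclideanSpace ℝ (Fin 2))} {G ν : EuclideanSpace ℝ (Fin 2) → Fin 4 → ℝ}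
  (H : IsPlaneSurface Ω G ν) (hΩ : IsOpen Ω) {y : EuclideanSpace ℝ (Fin 2)} (hy : y ∈ Ω)
include H hΩ hy

lemma hasFDerivAt : HasFDerivAt G (fderiv ℝ G y) y :=
  ((H.smooth.contDiffAt (hΩ.mem_nhds hy)).differentiableAt (by simp)).hasFDerivAt

lemma hasFDerivAt_normal : HasFDerivAt ν (fderiv ℝ ν y) y :=
  ((H.smooth_normal.contDiffAt (hΩ.mem_nhds hy)).differentiableAt (by simp)).hasFDerivAt

lemma hasFDerivAt_fderiv : HasFDerivAt (fderiv ℝ G) (fderiv ℝ (fderiv ℝ G) y) y :=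
  (((H.smooth.contDiffAt (hΩ.mem_nhds hy)).fderiv_right (m := 1)
    two_le_infty).differentiableAt (by simp)).hasFDerivAt

lemma hasFDerivAt_fderiv_apply (u : EuclideanSpace ℝ (Fin 2)) :
    HasFDerivAt (fun z => fderiv ℝ G z u) ((fderiv ℝ (fderiv ℝ G) y).flip u) y := by
  have := (H.hasFDerivAt_fderiv hΩ hy).clm_apply (hasFDerivAt_const u y)
  simpa using this

lemma isFrameDerivative : IsFrameDerivative (G y) (fderiv ℝ G y) (ν y)
    (fderiv ℝ (fderiv ℝ G) y) (fderiv ℝ ν y) := by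
  have hG := H.hasFDerivAt hΩ hy
  have hN := H.hasFDerivAt_normal hΩ hy
  have hev : ∀ᶠ z in nhds y, z ∈ Ω := hΩ.eventually_mem hy
  refine ⟨fun u v => ?_, fun u v => ?_, fun u => ?_, fun u v => ?_, fun u => ?_⟩
  · exact ((H.smooth.contDiffAt (hΩ.mem_nhds hy)).isSymmSndFDerivAt
      (by simpa [one_add_one_eq_two] using two_le_infty)) u v
  · have := apply_eq_zero_of_eventually_const hG (H.hasFDerivAt_fderiv_apply hΩ hy v) (c := 0)
      (hev.mono fun z hz => (H.frame z hz).position_tangent v) u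
    simp only [ContinuousLinearMap.flip_apply] at this
    linarith
  · have := apply_eq_zero_of_eventually_const hG hN (c := 0)
      (hev.mono fun z hz => (H.frame z hz).position_normal) u
    rw [mink_comm, (H.frame y hy).normal_tangent] at this
    linarith
  · have := apply_eq_zero_of_eventually_const hN (H.hasFDerivAt_fderiv_apply hΩ hy v) (c := 0)
      (hev.mono fun z hz => (H.frame z hz).normal_tangent v) u
    simp only [ContinuousLinearMap.flip_apply] at this
    rw [mink_comm (fderiv ℝ ν y u)] at this
    linarith
  · have := apply_eq_zero_of_eventually_const hN hN (c := 1)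
      (hev.mono fun z hz => (H.frame z hz).norm_normal) u
    rw [mink_comm (fderiv ℝ ν y u)] at this
    linarith

omit hΩ hy in
/-- The derivative of the moving frame of the surface. -/
lemma hasFDerivAt_frameMap (hΩ : IsOpen Ω) (hy : y ∈ Ω) :
    ∃ T : EuclideanSpace ℝ (Fin 2) →L[ℝ]
        (ℝ × EuclideanSpace ℝ (Fin 2) × ℝ) →L[ℝ] (Fin 4 → ℝ),
      HasFDerivAt (fun z => frameMap (G z) (fderiv ℝ G z) (ν z)) T y ∧
      ∀ w, T w = frameMap (fderiv ℝ G y w) (fderiv ℝ (fderiv ℝ G) y w) (fderiv ℝ ν y w) := by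
  let p := (ContinuousLinearMap.fst ℝ (EuclideanSpace ℝ (Fin 2)) ℝ).comp
        (ContinuousLinearMap.snd ℝ ℝ (EuclideanSpace ℝ (Fin 2) × ℝ))
  let q := (ContinuousLinearMap.snd ℝ (EuclideanSpace ℝ (Fin 2)) ℝ).comp
        (ContinuousLinearMap.snd ℝ ℝ (EuclideanSpace ℝ (Fin 2) × ℝ))
  have h1 := (ContinuousLinearMap.smulRightL ℝ (ℝ × EuclideanSpace ℝ (Fin 2) × ℝ) (Fin 4 → ℝ)
    (ContinuousLinearMap.fst ℝ ℝ (EuclideanSpace ℝ (Fin 2) × ℝ))).hasFDerivAt.comp y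
      (H.hasFDerivAt hΩ hy)
  have h2 := ((ContinuousLinearMap.compL ℝ (ℝ × EuclideanSpace ℝ (Fin 2) × ℝ)
    (EuclideanSpace ℝ (Fin 2)) (Fin 4 → ℝ)).flip p).hasFDerivAt.comp y
      (H.hasFDerivAt_fderiv hΩ hy)
  have h3 := (ContinuousLinearMap.smulRightL ℝ (ℝ × EuclideanSpace ℝ (Fin 2) × ℝ) (Fin 4 → ℝ)
    q).hasFDerivAt.comp y (H.hasFDerivAt_normal hΩ hy)
  exact ⟨_, h1.add (h2.add h3), fun w => rfl⟩

lemma hasFDerivAt_firstForm (u v : EuclideanSpace ℝ (Fin 2)) :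
    ∃ T : EuclideanSpace ℝ (Fin 2) →L[ℝ] ℝ,
      HasFDerivAt (fun z => mink (fderiv ℝ G z u) (fderiv ℝ G z v)) T y ∧
      ∀ w, T w = mink (fderiv ℝ (fderiv ℝ G) y w u) (fderiv ℝ G y v)
        + mink (fderiv ℝ G y u) (fderiv ℝ (fderiv ℝ G) y w v) :=
  hasFDerivAt_mink (H.hasFDerivAt_fderiv_apply hΩ hy u) (H.hasFDerivAt_fderiv_apply hΩ hy v)

end IsPlaneSurface

variable {Ω : Set (EuclideanSpace ℝ (Fin 2))} {G ν G' ν' : EuclideanSpace ℝ (Fin 2) → Fin 4 → ℝ}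

/-- The Christoffel symbols of the first kind are determined by the first fundamental form. -/
lemma mink_fderiv_second_eq (H : IsPlaneSurface Ω G ν) (H' : IsPlaneSurface Ω G' ν')
    (hΩ : IsOpen Ω)
    (hI : ∀ y ∈ Ω, ∀ u v, mink (fderiv ℝ G y u) (fderiv ℝ G y v)
      = mink (fderiv ℝ G' y u) (fderiv ℝ G' y v))
    {y : EuclideanSpace ℝ (Fin 2)} (hy : y ∈ Ω) (a u w : EuclideanSpace ℝ (Fin 2)) :
    mink (fderiv ℝ G y a) (fderiv ℝ (fderiv ℝ G) y w u)
      = mink (fderiv ℝ G' y a) (fderiv ℝ (fderiv ℝ G') y w u) := by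
  have key (u v w : EuclideanSpace ℝ (Fin 2)) :
      mink (fderiv ℝ G y v) (fderiv ℝ (fderiv ℝ G) y w u)
        + mink (fderiv ℝ G y u) (fderiv ℝ (fderiv ℝ G) y w v)
      = mink (fderiv ℝ G' y v) (fderiv ℝ (fderiv ℝ G') y w u)
        + mink (fderiv ℝ G' y u) (fderiv ℝ (fderiv ℝ G') y w v) := by
    obtain ⟨T, hT, h1⟩ := H.hasFDerivAt_firstForm hΩ hy u v
    obtain ⟨T', hT', h1'⟩ := H'.hasFDerivAt_firstForm hΩ hy u v
    have := hT.unique (hT'.congr_of_eventuallyEq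
      ((hΩ.eventually_mem hy).mono fun z hz => hI z hz u v))
    rw [mink_comm (fderiv ℝ G y v), mink_comm (fderiv ℝ G' y v), ← h1, ← h1', this]
  have s := (H.isFrameDerivative hΩ hy).symm
  have s' := (H'.isFrameDerivative hΩ hy).symm
  have k1 := key u a w
  have k2 := key w a u
  have k3 := key u w a
  -- Koszul's trick: with the second derivatives symmetric, a signed sum of the three permuted
  -- identities isolates one Christoffel symbol.
  rw [s u w, s' u w, s u a, s' u a] at k2
  rw [s w a, s' w a] at k1
  linarith

/-- Two surfaces over a plane domain with the same first and second fundamental forms are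
congruent. -/
theorem IsPlaneSurface.exists_congruence (H : IsPlaneSurface Ω G ν)
    (H' : IsPlaneSurface Ω G' ν') (hΩ : IsOpen Ω) (hconn : IsPreconnected Ω)
    (hI : ∀ y ∈ Ω, ∀ u v, mink (fderiv ℝ G y u) (fderiv ℝ G y v)
      = mink (fderiv ℝ G' y u) (fderiv ℝ G' y v))
    (hII : ∀ y ∈ Ω, ∀ u v, mink (fderiv ℝ G y u) (fderiv ℝ ν y v)
      = mink (fderiv ℝ G' y u) (fderiv ℝ ν' y v))
    {y₀ : EuclideanSpace ℝ (Fin 2)} (hy₀ : y₀ ∈ Ω) :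
    ∃ Φ : (Fin 4 → ℝ) →L[ℝ] (Fin 4 → ℝ), (∀ ξ η, mink (Φ ξ) (Φ η) = mink ξ η) ∧
      ∀ y ∈ Ω, Φ (G' y) = G y ∧ Φ (ν' y) = ν y := by
  set F := fun z => frameMap (G z) (fderiv ℝ G z) (ν z) with hF
  set F' := fun z => frameMap (G' z) (fderiv ℝ G' z) (ν' z) with hF'
  have hgram (y) (hy : y ∈ Ω) (X Y) : mink (F y X) (F y Y) = mink (F' y X) (F' y Y) := by
    simp only [hF, hF', (H.frame y hy).mink_frameMap, (H'.frame y hy).mink_frameMap, hI y hy]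
  -- The map carrying the second frame to the first; the theorem amounts to its being constant.
  let M := fun z => (F z).comp (F' z).inverse
  have hinv (y) (hy : y ∈ Ω) : ∃ e : (ℝ × EuclideanSpace ℝ (Fin 2) × ℝ) ≃L[ℝ] (Fin 4 → ℝ),
      (e : (ℝ × EuclideanSpace ℝ (Fin 2) × ℝ) →L[ℝ] (Fin 4 → ℝ)) = F' y := by
    refine ⟨(LinearEquiv.ofBijective (F' y : _ →ₗ[ℝ] (Fin 4 → ℝ))
      (H'.frame y hy).frameMap_bijective).toContinuousLinearEquiv, ?_⟩
    exact ContinuousLinearMap.ext fun X => rfl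
  have hM (y) (hy : y ∈ Ω) (X) : M y (F' y X) = F y X := by
    obtain ⟨e, he⟩ := hinv y hy
    simp only [M, ← he, ContinuousLinearMap.inverse_equiv]
    simp
  have hMpres (y) (hy : y ∈ Ω) (ξ η) : mink (M y ξ) (M y η) = mink ξ η := by
    obtain ⟨X, rfl⟩ := (H'.frame y hy).frameMap_bijective.2 ξ
    obtain ⟨Y, rfl⟩ := (H'.frame y hy).frameMap_bijective.2 η
    rw [hM y hy, hM y hy, hgram y hy]
  have hdM (y) (hy : y ∈ Ω) : HasFDerivAt M (0 : EuclideanSpace ℝ (Fin 2) →L[ℝ] _) y := by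
    obtain ⟨e, he⟩ := hinv y hy
    obtain ⟨T, hT, hTw⟩ := H.hasFDerivAt_frameMap hΩ hy
    obtain ⟨T', hT', hTw'⟩ := H'.hasFDerivAt_frameMap hΩ hy
    have hdiff : DifferentiableAt ℝ M y := by
      have h1 : DifferentiableAt ℝ ContinuousLinearMap.inverse (F' y) := by
        rw [← he]
        exact (contDiffAt_map_inverse (n := 1) e).differentiableAt (by simp)
      exact hT.differentiableAt.clm_comp (h1.comp y hT'.differentiableAt)
    have hD := hdiff.hasFDerivAt
    suffices hz : fderiv ℝ M y = 0 by rwa [hz] at hD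
    ext1 w
    ext1 ζ
    obtain ⟨Y, rfl⟩ := (H'.frame y hy).frameMap_bijective.2 ζ
    have h1 := hD.clm_apply (hT'.clm_apply (hasFDerivAt_const Y y))
    have h2 := hT.clm_apply (hasFDerivAt_const Y y)
    have h3 := h1.unique (h2.congr_of_eventuallyEq
      ((hΩ.eventually_mem hy).mono fun z hz => hM z hz Y))
    have h4 := DFunLike.congr_fun h3 w
    simp only [add_apply, ContinuousLinearMap.comp_apply,
      ContinuousLinearMap.flip_apply, zero_apply, map_zero, zero_add,
      hTw, hTw'] at h4
    -- Both sides are compared by pairing with the frame of `G`. As `M y` is an isometry, the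
    -- pairings on the left are those of the primed frame with its derivative, and all of them are
    -- expressed by `I`, `II` and the Christoffel symbols.
    have h5 : M y (frameMap (fderiv ℝ G' y w) (fderiv ℝ (fderiv ℝ G') y w) (fderiv ℝ ν' y w) Y)
        = frameMap (fderiv ℝ G y w) (fderiv ℝ (fderiv ℝ G) y w) (fderiv ℝ ν y w) Y := by
      apply eq_of_forall_mink_eq
      intro ξ
      obtain ⟨X, rfl⟩ := (H.frame y hy).frameMap_bijective.2 ξ
      have h6 : frameMap (G y) (fderiv ℝ G y) (ν y) X = M y (F' y X) := (hM y hy X).symm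
      conv_lhs => rw [h6]
      rw [hMpres y hy]
      have A := H.frame y hy
      have A' := H'.frame y hy
      have B := H.isFrameDerivative hΩ hy
      have B' := H'.isFrameDerivative hΩ hy
      simp only [hF', frameMap_apply, mink_add_left, mink_smul_left, mink_add_right,
        mink_smul_right, A.position_tangent, A'.position_tangent, A.normal_tangent,
        A'.normal_tangent, B.position_second, B'.position_second, B.position_normal,
        B'.position_normal, B.normal_second, B'.normal_second, B.normal_normal, B'.normal_normal,
        hI y hy, hII y hy, mink_fderiv_second_eq H H' hΩ hI hy]
    rw [h5] at h4
    simpa using h4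
  have hconst (y) (hy : y ∈ Ω) : M y = M y₀ :=
    hΩ.is_const_of_fderiv_eq_zero hconn
      (fun z hz => (hdM z hz).differentiableAt.differentiableWithinAt)
      (fun z hz => (hdM z hz).fderiv) hy hy₀
  refine ⟨M y₀, hMpres y₀ hy₀, fun y hy => ?_⟩
  rw [← hconst y hy]
  have h1 := hM y hy (1, 0, 0)
  have h2 := hM y hy (0, 0, 1)
  simpa [hF, hF', frameMap_apply] using And.intro h1 h2

end Landslide

end

noncomputable section

namespace Landslide

/-! ### Rigidity of surfaces in hyperbolic space -/

variable {N : Type*} [TopologicalSpace N] [ChartedSpace (EuclideanSpace ℝ (Fin 2)) N]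

/-- The differential as a continuous linear map on the model plane. -/
def diffCLM (f : N → Fin 4 → ℝ) (x : N) : EuclideanSpace ℝ (Fin 2) →L[ℝ] (Fin 4 → ℝ) :=
  mfderiv (𝓡 2) 𝓘(ℝ, Fin 4 → ℝ) f x

/-- The manifold derivative at `x` is by definition read in the preferred chart at `x`, so no
transition map appears at its centre. -/
lemma hasFDerivAt_comp_chart_symm {f : N → Fin 4 → ℝ}
    (hf : ContMDiff (𝓡 2) 𝓘(ℝ, Fin 4 → ℝ) ∞ f) (x : N) :
    HasFDerivAt (f ∘ (chartAt (EuclideanSpace ℝ (Fin 2)) x).symm)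
      (diffCLM f x)
      (chartAt (EuclideanSpace ℝ (Fin 2)) x x) := by
  have h := ((hf x).mdifferentiableAt (by simp)).hasMFDerivAt.2
  simp only [mfld_simps] at h
  exact hasFDerivWithinAt_univ.1 h

lemma mink_dMap_add_of_const {f g : N → Fin 4 → ℝ}
    (hf : ContMDiff (𝓡 2) 𝓘(ℝ, Fin 4 → ℝ) ∞ f) (hg : ContMDiff (𝓡 2) 𝓘(ℝ, Fin 4 → ℝ) ∞ g)
    {c : ℝ} (hc : ∀ x, mink (f x) (g x) = c) (x : N) (u : TangentSpace (𝓡 2) x) :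
    mink (dMap f x u) (g x) + mink (f x) (dMap g x u) = 0 := by
  have := apply_eq_zero_of_eventually_const (hasFDerivAt_comp_chart_symm hf x)
    (hasFDerivAt_comp_chart_symm hg x) (c := c) (Filter.Eventually.of_forall fun y => hc _) u
  simp only [Function.comp_apply, OpenPartialHomeomorph.left_inv _ (mem_chart_source _ x)] at this
  exact this

lemma fderiv_comp_chart_symm [IsManifold (𝓡 2) ∞ N] {f : N → Fin 4 → ℝ}
    (hf : ContMDiff (𝓡 2) 𝓘(ℝ, Fin 4 → ℝ) ∞ f) (x₀ : N) {y : EuclideanSpace ℝ (Fin 2)}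
    (hy : y ∈ (chartAt (EuclideanSpace ℝ (Fin 2)) x₀).target) :
    fderiv ℝ (f ∘ (chartAt (EuclideanSpace ℝ (Fin 2)) x₀).symm) y
      = (diffCLM f ((chartAt (EuclideanSpace ℝ (Fin 2)) x₀).symm y)).comp
        (mfderiv (𝓡 2) (𝓡 2) (chartAt (EuclideanSpace ℝ (Fin 2)) x₀).symm y :
          EuclideanSpace ℝ (Fin 2) →L[ℝ] EuclideanSpace ℝ (Fin 2)) := by
  rw [← mfderiv_eq_fderiv]
  exact mfderiv_comp y ((hf _).mdifferentiableAt (by simp))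
    (mdifferentiableAt_atlas_symm (chart_mem_atlas _ x₀) hy)

namespace IsSurface

variable {f n : N → Fin 4 → ℝ} (H : IsSurface f n)
include H

lemma adaptedFrame (x : N) : IsAdaptedFrame (f x) (diffCLM f x) (n x) where
  norm_position := (H.mem_hyp3 x).1
  position_tangent u := by
    have := mink_dMap_add_of_const H.smooth H.smooth (fun x => (H.mem_hyp3 x).1) x u
    rw [mink_comm (dMap f x u)] at this
    change mink (f x) (dMap f x u) = 0
    linarith
  position_normal := H.normal_tangent x
  normal_tangent u := by rw [mink_comm]; exact H.normal_perp x u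
  norm_normal := H.normal_unit x
  injective := H.immersion x

lemma mink_position_dMap_normal (x : N) (u : TangentSpace (𝓡 2) x) :
    mink (f x) (dMap n x u) = 0 := by
  have := mink_dMap_add_of_const H.smooth H.smooth_normal H.normal_tangent x u
  rwa [H.normal_perp, zero_add] at this

lemma mink_normal_dMap_normal (x : N) (u : TangentSpace (𝓡 2) x) :
    mink (n x) (dMap n x u) = 0 := by
  have := mink_dMap_add_of_const H.smooth_normal H.smooth_normal H.normal_unit x u
  rw [mink_comm (dMap n x u)] at this
  linarith

/-- The derivative of the normal is tangent to the surface. -/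
lemma exists_dMap_normal_eq (x : N) (u : TangentSpace (𝓡 2) x) :
    ∃ v : TangentSpace (𝓡 2) x, dMap n x u = dMap f x v :=
  (H.adaptedFrame x).exists_frame_eq _ (H.mink_position_dMap_normal x u)
    (H.mink_normal_dMap_normal x u)

variable [IsManifold (𝓡 2) ∞ N]

lemma comp_chart_symm (x₀ : N) :
    IsPlaneSurface (chartAt (EuclideanSpace ℝ (Fin 2)) x₀).target
      (f ∘ (chartAt (EuclideanSpace ℝ (Fin 2)) x₀).symm)
      (n ∘ (chartAt (EuclideanSpace ℝ (Fin 2)) x₀).symm) where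
  smooth := by
    rw [← contMDiffOn_iff_contDiffOn]
    exact H.smooth.comp_contMDiffOn (contMDiffOn_chart_symm (I := 𝓡 2))
  smooth_normal := by
    rw [← contMDiffOn_iff_contDiffOn]
    exact H.smooth_normal.comp_contMDiffOn (contMDiffOn_chart_symm (I := 𝓡 2))
  frame y hy := by
    have A := H.adaptedFrame ((chartAt (EuclideanSpace ℝ (Fin 2)) x₀).symm y)
    rw [fderiv_comp_chart_symm H.smooth x₀ hy]
    refine ⟨A.norm_position, fun u => A.position_tangent _, A.position_normal,
      fun u => A.normal_tangent _, A.norm_normal, A.injective.comp ?_⟩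
    have := ((mdifferentiable_chart (I := 𝓡 2) x₀).symm).mfderiv_injective (x := y) hy
    exact this

lemma secondForm_comm (x : N) (u v : TangentSpace (𝓡 2) x) :
    secondForm f n x u v = secondForm f n x v u := by
  have hx := mem_chart_target (EuclideanSpace ℝ (Fin 2)) x
  have P := (H.comp_chart_symm x).isFrameDerivative
    (chartAt (EuclideanSpace ℝ (Fin 2)) x).open_target hx
  have h1 := P.second_comm
  rw [(hasFDerivAt_comp_chart_symm H.smooth x).fderiv,
    (hasFDerivAt_comp_chart_symm H.smooth_normal x).fderiv] at h1
  exact h1 u v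

/-- Local uniqueness in the fundamental theorem of surface theory. -/
lemma exists_local_congruence {f' n' : N → Fin 4 → ℝ} (H' : IsSurface f' n')
    (hI : ∀ x u v, firstForm f x u v = firstForm f' x u v)
    (hII : ∀ x u v, secondForm f n x u v = secondForm f' n' x u v) (x₀ : N) :
    ∃ Φ : (Fin 4 → ℝ) →L[ℝ] (Fin 4 → ℝ), (∀ ξ η, mink (Φ ξ) (Φ η) = mink ξ η) ∧
      ∀ᶠ x in nhds x₀, Φ (f' x) = f x ∧ Φ (n' x) = n x := by
  set e := chartAt (EuclideanSpace ℝ (Fin 2)) x₀ with he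
  -- The chart target may be disconnected; a ball in it is not.
  obtain ⟨r, hr, hball⟩ := Metric.isOpen_iff.1 e.open_target _ (mem_chart_target _ x₀)
  have restrict {G ν : EuclideanSpace ℝ (Fin 2) → Fin 4 → ℝ} (h : IsPlaneSurface e.target G ν) :
      IsPlaneSurface (Metric.ball (e x₀) r) G ν :=
    ⟨h.smooth.mono hball, h.smooth_normal.mono hball, fun y hy => h.frame y (hball hy)⟩
  obtain ⟨Φ, hΦ, hΦ'⟩ := (restrict (H.comp_chart_symm x₀)).exists_congruence
    (restrict (H'.comp_chart_symm x₀)) Metric.isOpen_ball (convex_ball _ _).isPreconnected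
    (fun y hy u v => by
      rw [fderiv_comp_chart_symm H.smooth x₀ (hball hy),
        fderiv_comp_chart_symm H'.smooth x₀ (hball hy)]
      exact hI _ _ _)
    (fun y hy u v => by
      rw [fderiv_comp_chart_symm H.smooth x₀ (hball hy),
        fderiv_comp_chart_symm H'.smooth x₀ (hball hy),
        fderiv_comp_chart_symm H.smooth_normal x₀ (hball hy),
        fderiv_comp_chart_symm H'.smooth_normal x₀ (hball hy)]
      exact hII _ _ _)
    (Metric.mem_ball_self hr)
  refine ⟨Φ, hΦ, ?_⟩
  have h1 : ∀ᶠ x in nhds x₀, x ∈ e.source := e.open_source.mem_nhds (mem_chart_source _ x₀)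
  have h2 : ∀ᶠ x in nhds x₀, e x ∈ Metric.ball (e x₀) r :=
    (e.continuousAt (mem_chart_source _ x₀)).eventually_mem (Metric.ball_mem_nhds _ hr)
  filter_upwards [h1, h2] with x hx1 hx2
  have hl : (chartAt (EuclideanSpace ℝ (Fin 2)) x₀).symm (e x) = x := e.left_inv hx1
  simpa only [Function.comp_apply, hl] using hΦ' _ hx2

omit H [IsManifold (𝓡 2) ∞ N] in
lemma diffCLM_eq_of_eventuallyEq {f f' : N → Fin 4 → ℝ}
    (hf' : ContMDiff (𝓡 2) 𝓘(ℝ, Fin 4 → ℝ) ∞ f')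
    (hf : ContMDiff (𝓡 2) 𝓘(ℝ, Fin 4 → ℝ) ∞ f) {Φ : (Fin 4 → ℝ) →L[ℝ] (Fin 4 → ℝ)} {x : N}
    (h : ∀ᶠ y in nhds x, Φ (f' y) = f y) : Φ.comp (diffCLM f' x) = diffCLM f x := by
  have hx : Filter.Tendsto (chartAt (EuclideanSpace ℝ (Fin 2)) x).symm
      (nhds (chartAt (EuclideanSpace ℝ (Fin 2)) x x)) (nhds x) :=
    (chartAt (EuclideanSpace ℝ (Fin 2)) x).tendsto_symm (mem_chart_source _ x)
  have h1 := Φ.hasFDerivAt.comp _ (hasFDerivAt_comp_chart_symm hf' x)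
  exact h1.unique ((hasFDerivAt_comp_chart_symm hf x).congr_of_eventuallyEq (hx.eventually h))

/-- Uniqueness in the fundamental theorem of surface theory: surfaces with the same first and
second fundamental forms are congruent. -/
theorem exists_congruence [ConnectedSpace N] {f' n' : N → Fin 4 → ℝ} (H' : IsSurface f' n')
    (hI : ∀ x u v, firstForm f x u v = firstForm f' x u v)
    (hII : ∀ x u v, secondForm f n x u v = secondForm f' n' x u v) :
    ∃ Φ : (Fin 4 → ℝ) →L[ℝ] (Fin 4 → ℝ),
      IsHypIsometry (Φ : (Fin 4 → ℝ) →ₗ[ℝ] (Fin 4 → ℝ)) ∧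
      ∀ x, Φ (f' x) = f x ∧ Φ (n' x) = n x := by
  choose Φ hΦ hloc using H.exists_local_congruence H' hI hII
  -- Where two local congruences overlap they agree on position, differential and normal at a point,
  -- and these span Minkowski space.
  have hconst : IsLocallyConstant Φ := by
    rw [IsLocallyConstant.iff_eventually_eq]
    intro x
    filter_upwards [(hloc x).eventually_nhds] with y hy
    refine (H'.adaptedFrame y).linearMap_ext ?_ (fun u => ?_) ?_
    · rw [(hloc y).self_of_nhds.1, hy.self_of_nhds.1]
    · have h1 := diffCLM_eq_of_eventuallyEq H'.smooth H.smooth ((hloc y).mono fun _ h => h.1)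
      have h2 := diffCLM_eq_of_eventuallyEq H'.smooth H.smooth (hy.mono fun _ h => h.1)
      exact DFunLike.congr_fun (h1.trans h2.symm) u
    · rw [(hloc y).self_of_nhds.2, hy.self_of_nhds.2]
  obtain ⟨x₀⟩ := (inferInstance : Nonempty N)
  have key (x) : Φ x₀ (f' x) = f x ∧ Φ x₀ (n' x) = n x := by
    rw [hconst.apply_eq_of_preconnectedSpace x₀ x]
    exact (hloc x).self_of_nhds
  refine ⟨Φ x₀, isHypIsometry_of_apply_mem (hΦ x₀) (H'.mem_hyp3 x₀) ?_, key⟩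
  have := H.mem_hyp3 x₀
  rwa [← (key x₀).1] at this

omit [IsManifold (𝓡 2) ∞ N] in
/-- A congruence of surfaces that agree to first order at one point is the identity. -/
lemma eq_of_firstOrder_eq {f' n' : N → Fin 4 → ℝ} (H' : IsSurface f' n')
    {Φ : (Fin 4 → ℝ) →L[ℝ] (Fin 4 → ℝ)} (hΦ : ∀ x, Φ (f' x) = f x ∧ Φ (n' x) = n x) {x₀ : N}
    (h1 : f x₀ = f' x₀) (h2 : dMap f x₀ = dMap f' x₀) (h3 : n x₀ = n' x₀) :
    f = f' ∧ n = n' := by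
  have hid : Φ = ContinuousLinearMap.id ℝ _ := by
    refine (H'.adaptedFrame x₀).linearMap_ext ?_ (fun u => ?_) ?_
    · rw [(hΦ x₀).1, h1]; rfl
    · have h := diffCLM_eq_of_eventuallyEq H'.smooth H.smooth (x := x₀)
        (Filter.Eventually.of_forall fun y => (hΦ y).1)
      exact (DFunLike.congr_fun h u).trans (congrFun h2 u)
    · rw [(hΦ x₀).2, h3]; rfl
  subst hid
  exact ⟨funext fun x => (hΦ x).1.symm, funext fun x => (hΦ x).2.symm⟩

end IsSurface

end Landslide

end

noncomputable section

namespace Landslide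

/-! ### The first and third fundamental forms determine the second one -/

/-- Uniqueness of the positive square root of a symmetric `2 × 2` matrix: `(tr B)² = tr B² + 2 det
B` gives the trace, and then the entries of `B²` divided by the trace give `b` and `a - c`. -/
lemma eq_of_sq_eq {a b c a' b' c' : ℝ} (h1 : a ^ 2 + b ^ 2 = a' ^ 2 + b' ^ 2)
    (h2 : b * (a + c) = b' * (a' + c')) (h3 : b ^ 2 + c ^ 2 = b' ^ 2 + c' ^ 2)
    (hd : a * c - b ^ 2 = a' * c' - b' ^ 2) (ha : 0 < a) (hc : 0 < c) (ha' : 0 < a')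
    (hc' : 0 < c') : a = a' ∧ b = b' ∧ c = c' := by
  have ht : a + c = a' + c' := by
    have h : (a + c) ^ 2 = (a' + c') ^ 2 := by linear_combination h1 + h3 + 2 * hd
    exact (sq_eq_sq₀ (by positivity) (by positivity)).1 h
  have hpos : 0 < a + c := by positivity
  have hb : b = b' := by
    rw [← ht] at h2
    exact mul_right_cancel₀ hpos.ne' h2
  have hs : (a - c) * (a + c) = (a' - c') * (a + c) := by
    rw [ht]
    have : (a - c) * (a + c) = (a' - c') * (a' + c') := by linear_combination h1 - h3
    rwa [ht] at this
  have := mul_right_cancel₀ hpos.ne' hs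
  exact ⟨by linarith, hb, by linarith⟩

/-- `k` and `m` are second and third fundamental forms for the metric `g` of a plane `T` and
the positive determinant `d` of the shape operator. -/
structure IsSecondForm {T : Type*} [AddCommGroup T] [Module ℝ T]
    (g : T →ₗ[ℝ] T →ₗ[ℝ] ℝ) (m : T → T → ℝ) (d : ℝ) (k : T → T → ℝ) : Prop where
  symm (u v : T) : k u v = k v u
  pos (u : T) (hu : u ≠ 0) : 0 < k u u
  shape (v : T) : ∃ w, ∀ u, k u v = g u w
  third (u v w z : T) (hw : ∀ a, k a u = g a w) (hz : ∀ a, k a v = g a z) : m u v = g w z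
  gram (u v : T) : k u u * k v v - k u v * k v u = d * (g u u * g v v - g u v * g v u)

namespace IsSecondForm

variable {T : Type*} [AddCommGroup T] [Module ℝ T]
  {g : T →ₗ[ℝ] T →ₗ[ℝ] ℝ} {m : T → T → ℝ} {d : ℝ} {k k' : T → T → ℝ}

lemma eq_frame (H : IsSecondForm g m d k) {e e' : T}
    (he : ∀ u, u = g e u • e + g e' u • e') (u v : T) :
    k u v = g e u * (g e v * k e e + g e' v * k e e')
      + g e' u * (g e v * k e e' + g e' v * k e' e') := by
  have left (u v : T) : k u v = g e u * k e v + g e' u * k e' v := by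
    obtain ⟨w, hw⟩ := H.shape v
    rw [hw, hw, hw]
    conv_lhs => rw [he u]
    simp
  rw [left u v, H.symm e v, H.symm e' v, left v e, left v e', H.symm e' e]

/-- In an orthonormal frame this says that the matrix of `III` is the square of that of `II`. -/
lemma third_eq (H : IsSecondForm g m d k) {e e' : T} (he : ∀ u, u = g e u • e + g e' u • e')
    (u v : T) : m u v = k e u * k e v + k e' u * k e' v := by
  obtain ⟨w, hw⟩ := H.shape u
  obtain ⟨z, hz⟩ := H.shape v
  rw [H.third u v w z hw hz, hw, hw, hz, hz]
  conv_lhs => rw [he w]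
  simp

theorem unique (H : IsSecondForm g m d k) (H' : IsSecondForm g m d k') {e e' : T}
    (he : ∀ u, u = g e u • e + g e' u • e') (h1 : e ≠ 0) (h2 : e' ≠ 0) (u v : T) :
    k u v = k' u v := by
  have h11 := (H.third_eq he e e).symm.trans (H'.third_eq he e e)
  have h12 := (H.third_eq he e e').symm.trans (H'.third_eq he e e')
  have h22 := (H.third_eq he e' e').symm.trans (H'.third_eq he e' e')
  have hd := (H.gram e e').trans (H'.gram e e').symm
  simp only [H.symm e' e, H'.symm e' e] at h11 h12 h22 hd
  obtain ⟨ha, hb, hc⟩ := eq_of_sq_eq (b := k e e') (b' := k' e e') (by linarith) (by linarith) (by linarith) (by linarith)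
    (H.pos e h1) (H.pos e' h2) (H'.pos e h1) (H'.pos e' h2)
  rw [H.eq_frame he, H'.eq_frame he, ha, hb, hc]

end IsSecondForm

/-! ### The associated family of a bilinear form -/

lemma associated_eq {T : Type*} [AddCommGroup T] [Module ℝ T] {g : T → T → ℝ} {i : T → T}
    (hl : ∀ (a : ℝ) u v, g (a • u) v = a * g u v) (hr : ∀ (a : ℝ) u v, g u (a • v) = a * g u v)
    (z : ℂ) (u v : T) :
    2 * (z * part20 g i u v).re
      = (z.re * (g u v - g (i u) (i v)) + z.im * (g u (i v) + g (i u) v)) / 2 := by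
  simp only [part20, cExt, hl, hr, Complex.mul_re, Complex.add_re, Complex.add_im,
    Complex.ofReal_re, Complex.ofReal_im, Complex.I_re, Complex.I_im, Complex.mul_im]
  ring

lemma part11_eq {T : Type*} [AddCommGroup T] [Module ℝ T] {g : T → T → ℝ} {i : T → T}
    (hl : ∀ (a : ℝ) u v, g (a • u) v = a * g u v) (hr : ∀ (a : ℝ) u v, g u (a • v) = a * g u v)
    (u v : T) : part11 g i u v = (g u v + g (i u) (i v)) / 2 := by
  simp only [part11, cExt, hl, hr, Complex.mul_re, Complex.add_re,
    Complex.ofReal_re, Complex.ofReal_im, Complex.I_re, Complex.I_im]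
  ring

/-- Only `μ²` enters, so the choice of the square root is immaterial. -/
lemma circle_zpow_neg_two {μ : Circle} {θ : ℝ} (hμ : μ ^ 2 = Circle.exp θ) :
    ((μ : ℂ) ^ (-2 : ℤ)).re = Real.cos θ ∧ ((μ : ℂ) ^ (-2 : ℤ)).im = -Real.sin θ := by
  have h : (μ : ℂ) ^ (-2 : ℤ) = Complex.exp (((-θ : ℝ) : ℂ) * Complex.I) := by
    have h1 : ((μ ^ 2 : Circle) : ℂ) = Complex.exp (θ * Complex.I) := by
      rw [hμ, Circle.coe_exp]
    rw [zpow_neg, show (2 : ℤ) = ((2 : ℕ) : ℤ) from rfl, zpow_natCast, ← Circle.coe_pow, h1,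
      ← Complex.exp_neg]
    push_cast
    ring_nf
  rw [h, Complex.exp_ofReal_mul_I_re, Complex.exp_ofReal_mul_I_im, Real.cos_neg, Real.sin_neg]
  exact ⟨rfl, rfl⟩

/-! ### The landslide in a tangent plane -/

section Pointwise

variable {T V : Type*} [AddCommGroup T] [Module ℝ T] [AddCommGroup V] [Module ℝ V]
  {h area : V →ₗ[ℝ] V →ₗ[ℝ] ℝ} {J b : V →ₗ[ℝ] V}

/-- The operator `c + σ J b`. -/
def rotation (J b : V →ₗ[ℝ] V) (c σ : ℝ) : V →ₗ[ℝ] V := c • LinearMap.id + σ • (J ∘ₗ b)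

lemma rotation_apply (c σ : ℝ) (u : V) : rotation J b c σ u = c • u + σ • J (b u) := rfl

namespace IsLabouriePlane

variable (P : IsLabouriePlane h area J b) (D : T ≃ₗ[ℝ] V)
include P

/-- The complex structure of the second fundamental form `-κ h(·, b ·)`. -/
lemma complexStructure_eq {k : T → T → ℝ} {κ : ℝ} (hκ : 0 < κ)
    (hk : ∀ u v, k u v = -κ * h (D u) (b (D v))) (hpos : ∀ u, u ≠ 0 → 0 < k u u)
    {i : T →ₗ[ℝ] T} (hi : IsComplexStructure k (fun u v => area (D u) (D v)) i) (u : T) :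
    D (i u) = -J (b (D u)) := by
  have hb (U : V) (hU : U ≠ 0) : h U (b U) < 0 := by
    have h1 := hpos (D.symm U) (by simpa using hU)
    rw [hk] at h1
    simp only [LinearEquiv.apply_symm_apply] at h1
    nlinarith
  rcases eq_or_ne u 0 with rfl | hu
  · simp
  refine P.eq_of_isComplexStructure hb ?_ ?_ (hi.positive u hu)
  · have h1 := hi.isometry u (i u)
    rw [hi.sq, hk, hk] at h1
    simp only [map_neg, P.inner_b_comm (D (i u))] at h1
    have h2 : κ * h (D u) (b (D (i u))) = 0 := by linarith
    exact (mul_eq_zero.1 h2).resolve_left hκ.ne'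
  · have h1 := hi.isometry u u
    rw [hk, hk] at h1
    exact mul_left_cancel₀ (neg_ne_zero.2 hκ.ne') h1

omit P in
lemma inner_rotation (c σ : ℝ) (u v : V) :
    h (rotation J b c σ u) (rotation J b c σ v)
      = c ^ 2 * h u v + σ ^ 2 * h (J (b u)) (J (b v))
        + c * σ * (h u (J (b v)) + h (J (b u)) v) := by
  simp only [rotation_apply, map_add, map_smul, LinearMap.add_apply, LinearMap.smul_apply,
    smul_eq_mul]
  ring

/-! ### Rotated forms and the spectral parameter -/

section Associated

variable {i : T → T} (hi : ∀ u, D (i u) = -J (b (D u))) {k : T → T → ℝ} {C : ℝ}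
  (hk : ∀ u v, k u v = C ^ 2 * h (D u) (D v))
  {μ : Circle} {θ : ℝ} (hμ : μ ^ 2 = Circle.exp θ)
include hi hk hμ

omit P in
-- For `i = -J b` the rotation is `e^{-√-1 θ/2}`, and a `(2,0)`-form picks up the square of this
-- factor; in real terms these are the double-angle formulas.
lemma associated_first (u v : T) :
    2 * ((μ : ℂ) ^ (-2 : ℤ) * part20 k i u v).re + part11 k i u v
      = C ^ 2 * h (rotation J b (Real.cos (θ / 2)) (Real.sin (θ / 2)) (D u))
        (rotation J b (Real.cos (θ / 2)) (Real.sin (θ / 2)) (D v)) := by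
  have hl (a : ℝ) (u v : T) : k (a • u) v = a * k u v := by simp [hk]; ring
  have hr (a : ℝ) (u v : T) : k u (a • v) = a * k u v := by simp [hk]; ring
  rw [associated_eq hl hr, part11_eq hl hr, (circle_zpow_neg_two hμ).1,
    (circle_zpow_neg_two hμ).2, inner_rotation]
  have hc : Real.cos θ = 2 * Real.cos (θ / 2) ^ 2 - 1 := by
    rw [← Real.cos_two_mul]; ring_nf
  have hs : Real.sin θ = 2 * Real.sin (θ / 2) * Real.cos (θ / 2) := by
    rw [← Real.sin_two_mul]; ring_nf
  have h1 := Real.cos_sq_add_sin_sq (θ / 2)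
  simp only [hk, hi, map_neg, LinearMap.neg_apply, neg_neg, hc, hs]
  linear_combination (-C ^ 2 * h (J (b (D u))) (J (b (D v)))) * h1

omit P in
lemma associated_third (u v : T) :
    -(2 * ((μ : ℂ) ^ (-2 : ℤ) * part20 k i u v).re) + part11 k i u v
      = C ^ 2 * h (rotation J b (-Real.sin (θ / 2)) (Real.cos (θ / 2)) (D u))
        (rotation J b (-Real.sin (θ / 2)) (Real.cos (θ / 2)) (D v)) := by
  have hl (a : ℝ) (u v : T) : k (a • u) v = a * k u v := by simp [hk]; ring
  have hr (a : ℝ) (u v : T) : k u (a • v) = a * k u v := by simp [hk]; ring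
  rw [associated_eq hl hr, part11_eq hl hr, (circle_zpow_neg_two hμ).1,
    (circle_zpow_neg_two hμ).2, inner_rotation]
  have hc : Real.cos θ = 2 * Real.cos (θ / 2) ^ 2 - 1 := by
    rw [← Real.cos_two_mul]; ring_nf
  have hs : Real.sin θ = 2 * Real.sin (θ / 2) * Real.cos (θ / 2) := by
    rw [← Real.sin_two_mul]; ring_nf
  have h1 := Real.cos_sq_add_sin_sq (θ / 2)
  simp only [hk, hi, map_neg, LinearMap.neg_apply, neg_neg, hc, hs]
  linear_combination (-C ^ 2 * h (D u) (D v)) * h1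

end Associated

/-! ### Invariance of the second form under rotation -/

variable {c σ : ℝ} (hcs : c ^ 2 + σ ^ 2 = 1)

/-- The metric `C² h((c + σ J b) ·, (c + σ J b) ·)` on `T`. -/
def _root_.Landslide.rotatedMetric (h : V →ₗ[ℝ] V →ₗ[ℝ] ℝ) (J b : V →ₗ[ℝ] V) (D : T ≃ₗ[ℝ] V)
    (C c σ : ℝ) : T →ₗ[ℝ] T →ₗ[ℝ] ℝ :=
  C ^ 2 • h.compl₁₂ (rotation J b c σ ∘ₗ D) (rotation J b c σ ∘ₗ D)

omit P in
lemma _root_.Landslide.rotatedMetric_apply (C c σ : ℝ) (u v : T) :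
    rotatedMetric h J b D C c σ u v
      = C ^ 2 * h (rotation J b c σ (D u)) (rotation J b c σ (D v)) := rfl

include hcs in
lemma rotation_surjective (U : V) : ∃ u : T, rotation J b c σ (D u) = U :=
  ⟨D.symm (c • U - σ • J (b U)), by
    rw [LinearEquiv.apply_symm_apply, rotation_apply, P.rotation_rotation hcs]⟩

include hcs in
lemma rotation_injective {u v : V} (huv : rotation J b c σ u = rotation J b c σ v) : u = v := by
  have h1 := P.rotation_rotation (c := c) (σ := -σ) (by simpa using hcs) u
  have h2 := P.rotation_rotation (c := c) (σ := -σ) (by simpa using hcs) v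
  simp only [neg_smul, sub_neg_eq_add, ← rotation_apply] at h1 h2
  rw [← h1, ← h2, huv]

include hcs in
lemma exists_rotated_frame {C : ℝ} (hC : C ≠ 0) :
    ∃ e e' : T, e ≠ 0 ∧ e' ≠ 0 ∧ ∀ u, u = rotatedMetric h J b D C c σ e u • e
      + rotatedMetric h J b D C c σ e' u • e' := by
  obtain ⟨e, hee, he⟩ := P.exists_frame
  have hJJ : h (J e) (J e) = 1 := (P.complex.isometry e e).trans hee
  obtain ⟨ε, hε⟩ := P.rotation_surjective D hcs (C⁻¹ • e)
  obtain ⟨ε', hε'⟩ := P.rotation_surjective D hcs (C⁻¹ • J e)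
  refine ⟨ε, ε', ?_, ?_, fun u => ?_⟩
  · rintro rfl
    have : e = 0 := by simpa [hC] using hε.symm
    simp [this] at hee
  · rintro rfl
    have : J e = 0 := by simpa [hC] using hε'.symm
    simp [this] at hJJ
  · apply D.injective
    apply P.rotation_injective hcs
    simp only [rotatedMetric_apply, map_add, map_smul, hε, hε', LinearMap.smul_apply, smul_eq_mul,
      smul_smul]
    conv_lhs => rw [he (rotation J b c σ (D u))]
    congr 2 <;> field_simp

include hcs in
/-- The second fundamental form is the same for all members of the landslide. -/
lemma isSecondForm {k : T → T → ℝ} {C S : ℝ} (hC : C ≠ 0)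
    (hk : ∀ u v, k u v = -(S * C) * h (D u) (b (D v))) (hpos : ∀ u, u ≠ 0 → 0 < k u u) :
    IsSecondForm (rotatedMetric h J b D C c σ)
      (fun u v => S ^ 2 * h (rotation J b (-σ) c (D u)) (rotation J b (-σ) c (D v)))
      ((S / C) ^ 2) k := by
  -- In this form the shape operator of the rotated metric can be read off: up to `S / C` it is the
  -- first rotation's inverse, after `J`, after the second rotation.
  have hkJ (u v : T) : k u v = S * C *
      h (rotation J b c σ (D u)) (J (rotation J b (-σ) c (D v))) := by
    rw [hk, rotation_apply, rotation_apply, P.inner_rotation_J hcs]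
    ring
  have shape (v w : T) (hw : ∀ u, k u v = rotatedMetric h J b D C c σ u w) :
      rotation J b c σ (D w) = (S / C) • J (rotation J b (-σ) c (D v)) := by
    rw [← sub_eq_zero]
    by_contra hne
    -- The difference of the two sides is itself a rotated vector, so it may be used as test vector
    -- and has norm zero.
    have h1 := P.pos _ hne
    obtain ⟨u, hu⟩ := P.rotation_surjective D hcs
      (rotation J b c σ (D w) - (S / C) • J (rotation J b (-σ) c (D v)))
    have h2 := hw u
    rw [hkJ, rotatedMetric_apply, hu] at h2
    rw [map_sub, map_smul, smul_eq_mul] at h1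
    generalize rotation J b c σ (D w) - (S / C) • J (rotation J b (-σ) c (D v)) = z at h1 h2
    have h3 : h z (rotation J b c σ (D w)) = S / C * h z (J (rotation J b (-σ) c (D v))) := by
      field_simp
      apply mul_left_cancel₀ hC
      linear_combination -h2
    linarith
  refine ⟨fun u v => ?_, hpos, fun v => ?_, fun u v w z hw hz => ?_, fun u v => ?_⟩
  · rw [hk, hk, P.inner_b_comm]
  · obtain ⟨w, hw⟩ := P.rotation_surjective D hcs ((S / C) • J (rotation J b (-σ) c (D v)))
    refine ⟨w, fun u => ?_⟩
    rw [hkJ, rotatedMetric_apply, hw, map_smul, smul_eq_mul]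
    field_simp
  · have h1 := P.complex.isometry (rotation J b (-σ) c (D u)) (rotation J b (-σ) c (D v))
    rw [rotatedMetric_apply, shape u w hw, shape v z hz]
    simp only [map_smul, LinearMap.smul_apply, smul_eq_mul] at h1 ⊢
    rw [h1]
    field_simp
  · have h1 := P.gram_rotation hcs (D u) (D v)
    have h2 := P.gram_b (D u) (D v)
    simp only [rotatedMetric_apply, hk, rotation_apply]
    calc _ = (S * C) ^ 2 * (h (D u) (b (D u)) * h (D v) (b (D v))
          - h (D u) (b (D v)) * h (D v) (b (D u))) := by ring
      _ = (S / C) ^ 2 * (C ^ 4 * h (D u) (J (D v)) ^ 2) := by rw [h2]; field_simp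
      _ = _ := by rw [← h1]; ring

end IsLabouriePlane

end Pointwise

end Landslide

end

noncomputable section

namespace Landslide

/-! ### The landslide and the associated family -/

/-- Weingarten's equation `dn = df ∘ B` gives `III = I(B ·, B ·)`; the determinant condition is the
Gauss equation. -/
lemma IsSurface.isSecondForm {N : Type*} [TopologicalSpace N]
    [ChartedSpace (EuclideanSpace ℝ (Fin 2)) N] [IsManifold (𝓡 2) ∞ N] {f n : N → Fin 4 → ℝ}
    (H : IsSurface f n) {K : ℝ} (hK : HasGaussCurvature f n K) (x : N)
    {k : TangentSpace (𝓡 2) x →ₗ[ℝ] TangentSpace (𝓡 2) x →ₗ[ℝ] ℝ}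
    (hk : ∀ u v, firstForm f x u v = k u v)
    (hpos : ∀ u : TangentSpace (𝓡 2) x, u ≠ 0 → 0 < secondForm f n x u u) :
    IsSecondForm k (thirdForm n x) (K + 1) (secondForm f n x) where
  symm := H.secondForm_comm x
  pos := hpos
  shape v := by
    obtain ⟨w, hw⟩ := H.exists_dMap_normal_eq x v
    exact ⟨w, fun u => by rw [← hk, firstForm, ← hw, secondForm]⟩
  third u v w z hw hz := by
    have A := H.adaptedFrame x
    have key (v z : TangentSpace (𝓡 2) x) (hz : ∀ a, secondForm f n x a v = k a z) :
        dMap n x v = dMap f x z := by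
      apply eq_of_forall_mink_eq
      intro ζ
      obtain ⟨X, rfl⟩ := A.frameMap_bijective.2 ζ
      have h1 : mink (diffCLM f x X.2.1) (dMap n x v) = mink (diffCLM f x X.2.1) (dMap f x z) :=
        (hz X.2.1).trans (hk X.2.1 z).symm
      have h2 : mink (f x) (dMap f x z) = 0 := A.position_tangent z
      have h3 : mink (n x) (dMap f x z) = 0 := A.normal_tangent z
      simp only [frameMap_apply, mink_add_left, mink_smul_left, h1, h2, h3,
        H.mink_position_dMap_normal, H.mink_normal_dMap_normal]
    rw [← hk, firstForm, thirdForm, key u w hw, key v z hz]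
  gram u v := by rw [hK x u v, hk, hk, hk, hk]

section Bilinear

variable {V : Type*} [AddCommGroup V] [Module ℝ V] [TopologicalSpace V]

/-- A continuous bilinear form as a bilinear form. -/
def toBilin (A : V →L[ℝ] V →L[ℝ] ℝ) : V →ₗ[ℝ] V →ₗ[ℝ] ℝ :=
  LinearMap.mk₂ ℝ (fun u v => A u v) (by simp) (by simp) (by simp) (by simp)

end Bilinear

section

variable {M N : Type*}
    [TopologicalSpace M] [ChartedSpace (EuclideanSpace ℝ (Fin 2)) M] [IsManifold (𝓡 2) ∞ M]
    [TopologicalSpace N] [ChartedSpace (EuclideanSpace ℝ (Fin 2)) N] [IsManifold (𝓡 2) ∞ N]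

lemma IsLabourie.isLabouriePlane {o : OrientationForm M} {h hstar : SurfaceMetric M}
    {J : Π x : M, TangentSpace (𝓡 2) x →ₗ[ℝ] TangentSpace (𝓡 2) x}
    (hJ : ∀ x, IsComplexStructure (fun u v => h.inner x u v) (fun u v => o.form x u v) (J x))
    {b : Π x : M, TangentSpace (𝓡 2) x →L[ℝ] TangentSpace (𝓡 2) x}
    (hb : IsLabourie h hstar b) (y : M) :
    IsLabouriePlane (toBilin (h.inner y)) (toBilin (o.form y)) (J y)
      (b y : TangentSpace (𝓡 2) y →ₗ[ℝ] TangentSpace (𝓡 2) y) where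
  finrank := finrank_euclideanSpace_fin (𝕜 := ℝ)
  symm := h.symm y
  pos := h.pos y
  alternating := o.alternating y
  complex := hJ y
  self_adjoint := hb.self_adjoint y
  det_eq_one := hb.det_eq_one y

/-- The surfaces attached to the landslide are the members of the associated family. -/
theorem isAttached_landslide_iff {o : OrientationForm M}
    {p : N → M} (hp : IsUniversalCovering p) {h hstar : SurfaceMetric M}
    {J : Π x : M, TangentSpace (𝓡 2) x →ₗ[ℝ] TangentSpace (𝓡 2) x}
    (hJ : ∀ x, IsComplexStructure (fun u v => h.inner x u v) (fun u v => o.form x u v) (J x))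
    {b : Π x : M, TangentSpace (𝓡 2) x →L[ℝ] TangentSpace (𝓡 2) x}
    (hb : IsLabourie h hstar b) {s : ℝ} (hs : 0 < s) {f n : N → Fin 4 → ℝ}
    (hf : IsAttached p s
      (fun x u v => h.inner x u v, fun x u v => h.inner x (b x u) (b x v)) f n)
    (hB : HasShapeOperator p (fun x u => -Real.tanh (s / 2) • b x u) f n)
    {i : Π x : N, TangentSpace (𝓡 2) x →ₗ[ℝ] TangentSpace (𝓡 2) x}
    (hi : ∀ x, IsComplexStructure (secondForm f n x)
      (pullForm p (fun y u v => o.form y u v) x) (i x))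
    {θ : ℝ} {μ : Circle} (hμ : μ ^ 2 = Circle.exp θ) (g ν : N → Fin 4 → ℝ) :
    IsAttached p s (landslide h J b θ) g ν ↔ IsAssociated s i f n μ g ν := by
  set C := Real.cosh (s / 2) with hC
  set S := Real.sinh (s / 2) with hS
  have hC0 : 0 < C := Real.cosh_pos _
  have hS0 : 0 < S := Real.sinh_pos_iff.2 (by linarith)
  have htanh : Real.tanh (s / 2) = S / C := Real.tanh_eq_sinh_div_cosh _
  -- For this curvature the determinant of the shape operator is `tanh² (s / 2)`.
  have hd : -1 / C ^ 2 + 1 = (S / C) ^ 2 := by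
    have : C ^ 2 = S ^ 2 + 1 := Real.cosh_sq (s / 2)
    field_simp
    linarith
  set c := Real.cos (θ / 2) with hc
  set σ := Real.sin (θ / 2) with hσ
  have hcs : c ^ 2 + σ ^ 2 = 1 := Real.cos_sq_add_sin_sq _
  have hc' : Real.cos ((θ + Real.pi) / 2) = -σ := by
    rw [add_div, Real.cos_add_pi_div_two]
  have hσ' : Real.sin ((θ + Real.pi) / 2) = c := by
    rw [add_div, Real.sin_add_pi_div_two]
  let D (x : N) : TangentSpace (𝓡 2) x ≃ₗ[ℝ] TangentSpace (𝓡 2) (p x) :=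
    (hp.local_diffeo.mfderivToContinuousLinearEquiv (by simp) x).toLinearEquiv
  have P (x : N) := hb.isLabouriePlane hJ (p x)
  have hI (x : N) (u v : TangentSpace (𝓡 2) x) :
      firstForm f x u v = C ^ 2 * toBilin (h.inner (p x)) (D x u) (D x v) := hf.first x u v
  have hII (x : N) (u v : TangentSpace (𝓡 2) x) :
      secondForm f n x u v
        = -(S * C) * toBilin (h.inner (p x)) (D x u) ((b (p x)).toLinearMap (D x v)) := by
    -- The covering is a local diffeomorphism, so the shape operator on `M` lifts to tangent vectors
    -- of `N`.
    obtain ⟨w, hw⟩ := (D x).surjective (-Real.tanh (s / 2) • (b (p x)).toLinearMap (D x v))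
    rw [hB x u v w hw, hI, hw, map_smul, htanh, smul_eq_mul]
    field_simp
  have hi' (x : N) := (P x).complexStructure_eq (D x) (mul_pos hS0 hC0) (hII x) (hf.second_pos x)
    (hi x)
  have h1 (x : N) (u v : TangentSpace (𝓡 2) x) :
      C ^ 2 * pullForm p (landslide h J b θ).1 x u v
        = 2 * ((μ : ℂ) ^ (-2 : ℤ) * part20 (firstForm f x) (i x) u v).re
          + part11 (firstForm f x) (i x) u v :=
    (IsLabouriePlane.associated_first (D x) (hi' x) (hI x) hμ u v).symm
  have hm (x : N) (u v : TangentSpace (𝓡 2) x) :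
      pullForm p (landslide h J b θ).2 x u v
        = toBilin (h.inner (p x)) (rotation (J (p x)) (b (p x)).toLinearMap (-σ) c (D x u))
          (rotation (J (p x)) (b (p x)).toLinearMap (-σ) c (D x v)) := by
    rw [← hc', ← hσ']
    rfl
  have h3 (x : N) (u v : TangentSpace (𝓡 2) x) :
      S ^ 2 * pullForm p (landslide h J b θ).2 x u v
        = Real.tanh (s / 2) ^ 2 *
          (-(2 * ((μ : ℂ) ^ (-2 : ℤ) * part20 (firstForm f x) (i x) u v).re)
            + part11 (firstForm f x) (i x) u v) := by
    rw [IsLabouriePlane.associated_third (D x) (hi' x) (hI x) hμ u v, hm, htanh]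
    field_simp
    rfl
  have hform (x : N) := (P x).isSecondForm (D x) hcs hC0.ne' (hII x) (hf.second_pos x)
  constructor
  · intro hg
    refine ⟨hg.surface, fun x u v => ?_, fun x u v => ?_, fun x u v => ?_⟩
    · rw [hg.first, h1]
    -- The second forms of `g` and of `f` both solve the square-root problem for the rotated first
    -- and third forms, hence coincide.
    · obtain ⟨e, e', he, he', hframe⟩ := (P x).exists_rotated_frame (D x) hcs hC0.ne'
      have hg' := hg.surface.isSecondForm hg.curvature x
        (k := rotatedMetric (toBilin (h.inner (p x))) (J (p x)) (b (p x)).toLinearMap (D x) C c σ)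
        (hg.first x) (hg.second_pos x)
      have hthird : thirdForm ν x = fun u v => S ^ 2 *
          toBilin (h.inner (p x)) (rotation (J (p x)) (b (p x)).toLinearMap (-σ) c (D x u))
          (rotation (J (p x)) (b (p x)).toLinearMap (-σ) c (D x v)) := by
        funext u v
        rw [hg.third, hm]
      rw [hthird, hd] at hg'
      exact hg'.unique (hform x) hframe he he' u v
    · rw [hg.third, h3]
  · intro hg
    refine ⟨hg.surface, fun x u v => ?_, fun x u v => ?_, fun x u v => ?_, fun x u hu => ?_⟩
    · have hfirst (u v : TangentSpace (𝓡 2) x) : firstForm g x u v =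
          rotatedMetric (toBilin (h.inner (p x))) (J (p x)) (b (p x)).toLinearMap (D x) C c σ
            u v := by
        rw [hg.first, ← h1]
        rfl
      rw [hg.second, hg.second, hg.second, hg.second, (hform x).gram, hfirst, hfirst, hfirst,
        hfirst, hd]
    · rw [hg.first, h1]
    · rw [hg.third, h3]
    · rw [hg.second]
      exact hf.second_pos x u hu

end

end Landslide

end

/-- `M` is a closed oriented surface (its genus is at least two because it carries a hyperbolic
metric), `p : N → M` its universal covering, `(h, hstar)` a pair of hyperbolic metrics with Labourie
operator `b`; the second metric is represented in its isotopy class by `h(b ·, b ·)`.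
`(f, n)` is the surface attached to the pair, with shape operator `B = -tanh (s / 2) b`, which fixes
the sign of `b`, and `i` is the complex structure of its second fundamental form.
Then the surfaces attached to the landslide `L_θ(h, hstar)` are exactly the members of the
associated family of `(f, n)` with parameter a square root `μ` of `e^{√-1 θ}`; each of the two
descriptions determines the surface up to an isometry of hyperbolic space, and the two surfaces
coincide once they have the same first order data (position, tangent map, normal) at one point. -/
theorem proposition3p3
    {M N : Type*}
    [TopologicalSpace M] [ChartedSpace (EuclideanSpace ℝ (Fin 2)) M] [IsManifold (𝓡 2) ∞ M]
    [T2Space M] [CompactSpace M] [ConnectedSpace M]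
    [TopologicalSpace N] [ChartedSpace (EuclideanSpace ℝ (Fin 2)) N] [IsManifold (𝓡 2) ∞ N]
    (o : OrientationForm M)
    (p : N → M) (hp : IsUniversalCovering p)
    (h hstar : SurfaceMetric M) (hh : IsHyperbolic h) (hhstar : IsHyperbolic hstar)
    (J : Π x : M, TangentSpace (𝓡 2) x →ₗ[ℝ] TangentSpace (𝓡 2) x)
    (hJ : ∀ x, IsComplexStructure (fun u v => h.inner x u v) (fun u v => o.form x u v) (J x))
    (b : Π x : M, TangentSpace (𝓡 2) x →L[ℝ] TangentSpace (𝓡 2) x)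
    (hb : IsLabourie h hstar b)
    (s : ℝ) (hs : 0 < s)
    (f n : N → Fin 4 → ℝ)
    (hf : IsAttached p s
      (fun x u v => h.inner x u v, fun x u v => h.inner x (b x u) (b x v)) f n)
    (hB : HasShapeOperator p (fun x u => -Real.tanh (s / 2) • b x u) f n)
    (i : Π x : N, TangentSpace (𝓡 2) x →ₗ[ℝ] TangentSpace (𝓡 2) x)
    (hi : ∀ x, IsComplexStructure (secondForm f n x)
      (pullForm p (fun y u v => o.form y u v) x) (i x))
    (θ : ℝ) (μ : Circle) (hμ : μ ^ 2 = Circle.exp θ) :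
    (∀ g ν : N → Fin 4 → ℝ,
      IsAttached p s (landslide h J b θ) g ν ↔ IsAssociated s i f n μ g ν) ∧
    (∀ g ν g' ν' : N → Fin 4 → ℝ,
      IsAttached p s (landslide h J b θ) g ν → IsAssociated s i f n μ g' ν' →
      (∃ Φ : (Fin 4 → ℝ) →ₗ[ℝ] (Fin 4 → ℝ), IsHypIsometry Φ ∧
        ∀ x, g x = Φ (g' x) ∧ ν x = Φ (ν' x)) ∧
      ((∃ x₀, g x₀ = g' x₀ ∧ dMap g x₀ = dMap g' x₀ ∧ ν x₀ = ν' x₀) → g = g' ∧ ν = ν')) := by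
  -- Used only for the connectedness of `N`, over which the local congruences are glued.
  have : SimplyConnectedSpace N := hp.simply_connected
  have hiff := isAttached_landslide_iff hp hJ hb hs hf hB hi hμ
  refine ⟨hiff, fun g ν g' ν' hg hg' => ?_⟩
  have hg₁ := (hiff g ν).1 hg
  obtain ⟨Φ, hΦ, hΦ'⟩ := hg.surface.exists_congruence hg'.surface
    (fun x u v => by rw [hg₁.first, hg'.first]) (fun x u v => by rw [hg₁.second, hg'.second])
  refine ⟨⟨Φ, hΦ, fun x => ⟨(hΦ' x).1.symm, (hΦ' x).2.symm⟩⟩, ?_⟩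
  rintro ⟨x₀, h1, h2, h3⟩
  exact hg.surface.eq_of_firstOrder_eq hg'.surface hΦ' h1 h2 h3
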